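/- **Model.** Let $G=(V,E)$ be a finite simple graph with $n$ nodes and highest degree $\Delta$. Every node carries a unique identifier from an ID space $I$ with $|I|\ge n$, and a private random seed from a probability space $(\Omega,\mu)$; the seeds are independent. The view of a node $v$ after $k$ rounds is the subgraph induced by all nodes at distance at most $k$ from $v$, without the edges between two nodes at distance exactly $k$ from $v$, together with the identifiers and seeds of its nodes. A (randomized) $k$-round distributed algorithm is a function that maps the view of each node to its output; it is deterministic if it ignores the seeds. An algorithm for minimum dominating set (MDS) on $G$ has outputs in $\{0,1\}$ such that, for every assignment of identifiers, the nodes with output $1$ almost surely form a dominating set, i.e. each node is in the set or has a neighbour in it. An algorithm for fractional MDS on $G$ has outputs $x_v\ge 0$ such that, for every assignment of identifiers, almost surely $\sum_{u\in\Gamma_v}x_u\ge 1$ for all $v\in V$, where $\Gamma_v$ consists of $v$ and its neighbours. Outputs are measurable functions of the seeds. The approximation ratio of an algorithm on $G$ is the maximum (supremum), over all assignments of identifiers, of the expected size of the computed set (of the expected value of $\sum_v x_v$, respectively) divided by the optimum. **Theorem.** For every $\varepsilon>0$ there is a constant $c>0$ such that for every integer $k\ge 1$ there are graphs $G$, with $n$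 and $\Delta$ arbitrarily large, on which, for every ID space $I$ with $|I|\ge n$ and every $(\Omega,\mu)$, every (possibly randomized) $k$-round distributed algorithm for MDS has approximation ratio at least $$c\cdot n^{\frac{1/4-\varepsilon}{k^2}}\quad\text{and at least}\quad c\cdot\Delta^{\frac{1-\varepsilon}{k+1}},$$ and every (possibly randomized) $k$-round distributed algorithm for fractional MDS has approximation ratio at least $c\cdot n^{\frac{1/4-\varepsilon}{k^2}}$ and at least $c\cdot\Delta^{\frac{1-\varepsilon}{k+1}}$. -/

import Mathlib

open scoped NNReal ENNReal
open MeasureTheory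

noncomputable section

/-! ### The local model -/

/-- What a node can see of a network whose nodes carry labels in `L`: its own label, the labels
of the nodes in its field of vision, and the links between these nodes. As labels of distinct
nodes are distinct, this is a labelled rooted graph. -/
structure LocalView (L : Type*) where
  root : L
  nodes : Set L
  link : L → L → Prop

/-- The `k`-hop neighbourhood of `v`: all nodes at distance at most `k`. The extended distance
is used, so that nodes in other connected components do not belong to it. -/
def hopNeighborhood {V : Type*} (G : SimpleGraph V) (k : ℕ) (v : V) : Set V :=
  {u | G.edist v u ≤ k}

/-- The view of `v` after `k` rounds: the labelled graph induced by the `k`-hop neighbourhood of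
`v`, without the edges between two nodes that are both at distance exactly `k` from `v`. -/
def localView {V L : Type*} (G : SimpleGraph V) (k : ℕ) (label : V → L) (v : V) :
    LocalView L where
  root := label v
  nodes := label '' hopNeighborhood G k v
  link a b := ∃ u w : V, u ∈ hopNeighborhood G k v ∧ w ∈ hopNeighborhood G k v ∧ G.Adj u w ∧
    ¬ (G.edist v u = k ∧ G.edist v w = k) ∧ label u = a ∧ label w = b

/-- A randomized local algorithm: the output of a node is a function of its view, in which each
node is labelled by its identifier in `I` and its private random seed in `Ω`. A deterministic
algorithm is one that ignores the seeds (or whose seed space has one point). -/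
abbrev LocalAlgorithm (I Ω O : Type*) := LocalView (I × Ω) → O

/-- The outputs of all nodes of `G` when `A` is run for `k` rounds with identifiers `id` and
random seeds `ω`. -/
def LocalAlgorithm.run {I Ω O V : Type*} (A : LocalAlgorithm I Ω O) (G : SimpleGraph V) (k : ℕ)
    (id : V ↪ I) (ω : V → Ω) (v : V) : O :=
  A (localView G k (fun u => (id u, ω u)) v)

/-! ### Dominating sets -/

section Domination

variable {V : Type*} [Fintype V]

/-- The highest degree `Δ` of `G`. -/
def highestDegree (G : SimpleGraph V) : ℕ := by
  classical exact G.maxDegree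

/-- `S` is a dominating set: each node is in `S` or has a neighbour in `S`. -/
def IsDominatingSet {V : Type*} (G : SimpleGraph V) (S : Set V) : Prop :=
  ∀ v, v ∈ S ∨ ∃ u ∈ S, G.Adj v u

/-- The size of a minimum dominating set. -/
def dominationNumber (G : SimpleGraph V) : ℕ :=
  sInf {m | ∃ S : Set V, IsDominatingSet G S ∧ S.ncard = m}

open scoped Classical in
/-- `x` is a fractional dominating set, i.e. a feasible solution of the linear programming
relaxation: the values in each closed neighbourhood sum up to at least `1`. -/
def IsFractionalDominatingSet (G : SimpleGraph V) (x : V → ℝ≥0) : Prop :=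
  ∀ v, 1 ≤ ∑ u with u = v ∨ G.Adj v u, x u

/-- The optimal value of the linear programming relaxation of minimum dominating set. -/
def fractionalDominationNumber (G : SimpleGraph V) : ℝ≥0 :=
  sInf {s | ∃ x : V → ℝ≥0, IsFractionalDominatingSet G x ∧ ∑ v, x v = s}

end Domination

/-! ### Distributed algorithms for (fractional) minimum dominating set -/

section Algorithms

variable {V I Ω : Type*} [Fintype V] [MeasurableSpace Ω]

/-- The `k`-round algorithm `A` solves the dominating set problem on `G`: its outputs are random
variables and, whatever the identifiers are, the nodes with output `true` almost surely form a
dominating set. The seeds of the nodes are independent with distribution `μ`. -/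
def SolvesDominatingSet (A : LocalAlgorithm I Ω Bool) (G : SimpleGraph V) (k : ℕ)
    (μ : Measure Ω) [IsProbabilityMeasure μ] : Prop :=
  ∀ id : V ↪ I, (∀ v, Measurable fun ω : V → Ω => A.run G k id ω v) ∧
    ∀ᵐ ω ∂(Measure.pi fun _ : V => μ), IsDominatingSet G {v | A.run G k id ω v = true}

/-- The approximation ratio on `G` of a `k`-round dominating set algorithm: the expected size of
the computed set, divided by the optimum, for the worst assignment of identifiers. -/
def dominatingSetRatio (A : LocalAlgorithm I Ω Bool) (G : SimpleGraph V) (k : ℕ)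
    (μ : Measure Ω) [IsProbabilityMeasure μ] : ℝ≥0∞ :=
  ⨆ id : V ↪ I,
    (∫⁻ ω, (Set.ncard {v | A.run G k id ω v = true} : ℝ≥0∞) ∂(Measure.pi fun _ : V => μ)) /
      (dominationNumber G : ℝ≥0∞)

/-- The `k`-round algorithm `A` solves the fractional dominating set problem on `G`. -/
def SolvesFractionalDominatingSet (A : LocalAlgorithm I Ω ℝ≥0) (G : SimpleGraph V) (k : ℕ)
    (μ : Measure Ω) [IsProbabilityMeasure μ] : Prop :=
  ∀ id : V ↪ I, (∀ v, Measurable fun ω : V → Ω => A.run G k id ω v) ∧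
    ∀ᵐ ω ∂(Measure.pi fun _ : V => μ), IsFractionalDominatingSet G (A.run G k id ω)

/-- The approximation ratio on `G` of a `k`-round fractional dominating set algorithm: the
expected value of the computed solution, divided by the optimum, for the worst assignment of
identifiers. -/
def fractionalDominatingSetRatio (A : LocalAlgorithm I Ω ℝ≥0) (G : SimpleGraph V) (k : ℕ)
    (μ : Measure Ω) [IsProbabilityMeasure μ] : ℝ≥0∞ :=
  ⨆ id : V ↪ I,
    (∫⁻ ω, ((∑ v, A.run G k id ω v : ℝ≥0) : ℝ≥0∞) ∂(Measure.pi fun _ : V => μ)) /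
      (fractionalDominationNumber G : ℝ≥0∞)

end Algorithms

end

/-!
The lower bound of Kuhn, Moscibroda and Wattenhofer. There is a graph in which two adjacent nodes
`u` and `v u` have, after `k` rounds, isomorphic views, although `u` belongs to a large independent
set, the root cluster, and `v u` to a much smaller set of nodes which should dominate it. If the
identifiers are assigned in random order, then `u` and `v u` have the same expected output
(`IsViewIso.averageOutput_eq`). For each such `u` there is a node `w u`, attached to the edge, whose
only neighbours are `u` and `v u`; its constraint shows that the expected outputs of `u` and `w u`
sum up to at least `1 / 2` (`card_le_two_mul_iSup_lintegral`). So an algorithm pays for the whole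
root cluster, while the original nodes outside of it form a dominating set that is smaller by a
factor of order `δ`.

The graph is a blow-up of the cluster tree, whose clusters are words of labels: a node of the
cluster `w` has `δ ^ i` neighbours in the cluster `i :: w` and a node of `i :: w` has `δ ^ (i + 1)`
neighbours in `w`. The links of each cluster that is not a leaf have all labels `0, …, k`, so that a
node cannot tell its position from its degree. If the graph has no cycles of length at most `2 * k`,
views are trees, and the isomorphism between the view of a node of the root `[]` and that of a node
of `[0]` is built by increasing distance. Neighbours are matched by labels. As a walk may not return
by the edge on which it has arrived, one neighbour on either side may have to be matched with a
neighbour of another label. The invariant `SimilarArrivals` says when this is harmless: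
`SimilarClusters.similarArrivals_linkEnd` and `similarArrivals_linkEnd_of_le` are the two cases of
its preservation, and `IsClusterGraph.exists_isViewIso` is the result.

A graph of high girth with these degrees is one with the greatest number of edges among the graphs
of high girth that do not exceed them (`exists_highGirth_card_nbrsIn_eq`): if a node lacks a
neighbour, there is also a node lacking a neighbour on the other side, and either they can be
joined, or an edge `s(x, y)` far away from both can be replaced by two edges. This works as soon as
the clusters are larger than balls of radius `2 * k - 1`, which leads to about `δ ^ (4 * k ^ 2)`
nodes at most, and to a highest degree of order `δ ^ (k + 1)`. The constants depend on `k`, but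
they are smaller than `δ ^ ε` for large `δ`, so that `c = 1` suffices.
-/

/-! ### Bounded distances and graphs without short cycles -/

/-- `v` is at distance at most `n` from `u`, for a finite `n`. -/
def Within {V : Type*} (G : SimpleGraph V) (n : ℕ) (u v : V) : Prop :=
  G.edist u v ≤ n

section Within

variable {V : Type*} {G : SimpleGraph V}

theorem within_iff_exists_walk {n : ℕ} {u v : V} :
    Within G n u v ↔ ∃ p : G.Walk u v, p.length ≤ n := by
  constructor
  · intro h
    obtain ⟨p, hp⟩ := G.exists_walk_of_edist_ne_top
      (ne_top_of_le_ne_top (ENat.natCast_ne_top n) h)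
    refine ⟨p, ?_⟩
    have h' : (p.length : ℕ∞) ≤ n := hp ▸ h
    exact_mod_cast h'
  · rintro ⟨p, hp⟩
    exact (G.edist_le p).trans (by exact_mod_cast hp)

theorem Within.refl (n : ℕ) (u : V) : Within G n u u := by simp [Within]

theorem Within.symm {n : ℕ} {u v : V} (h : Within G n u v) : Within G n v u := by
  rwa [Within, SimpleGraph.edist_comm]

theorem Within.trans {m n : ℕ} {u v w : V} (h : Within G m u v) (h' : Within G n v w) :
    Within G (m + n) u w :=
  G.edist_triangle.trans (by push_cast; exact add_le_add h h')

theorem Within.mono {m n : ℕ} {u v : V} (h : Within G m u v) (hmn : m ≤ n) : Within G n u v :=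
  le_trans (show G.edist u v ≤ m from h) (by exact_mod_cast hmn)

theorem Within.mono_graph {H : SimpleGraph V} {n : ℕ} {u v : V} (h : Within G n u v)
    (hGH : G ≤ H) : Within H n u v :=
  (SimpleGraph.edist_anti hGH).trans h

theorem Within.of_adj {u v : V} (h : G.Adj u v) : Within G 1 u v :=
  (SimpleGraph.edist_eq_one_iff_adj.2 h).le

theorem within_zero_iff {u v : V} : Within G 0 u v ↔ u = v := by
  simp [Within]

theorem within_one_iff {u v : V} : Within G 1 u v ↔ G.Adj u v ∨ u = v := by
  simpa [Within] using G.edist_le_one_iff_adj_or_eq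

/-- A walk of length at most `n + 1` is trivial or has a last edge. -/
theorem within_succ_iff {n : ℕ} {u w : V} :
    Within G (n + 1) u w ↔ Within G n u w ∨ ∃ v, Within G n u v ∧ G.Adj v w := by
  constructor
  · intro h
    obtain ⟨p, hp⟩ := within_iff_exists_walk.1 h.symm
    cases p with
    | nil => exact Or.inl (Within.refl _ _)
    | cons hadj q =>
      refine Or.inr ⟨_, (within_iff_exists_walk.2 ⟨q, ?_⟩).symm, hadj.symm⟩
      simpa using hp
  · rintro (h | ⟨v, h, hadj⟩)
    · exact h.mono n.le_succ
    · exact h.trans (Within.of_adj hadj)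

theorem edist_eq_coe_iff {n : ℕ} {u v : V} :
    G.edist u v = n ↔ Within G n u v ∧ ∀ m < n, ¬ Within G m u v := by
  constructor
  · intro h
    refine ⟨h.le, fun m hm hw => ?_⟩
    rw [Within, h] at hw
    exact absurd (by exact_mod_cast hw : n ≤ m) (by omega)
  · rintro ⟨h, h'⟩
    refine le_antisymm h ?_
    by_contra hlt
    obtain ⟨m, hm⟩ := ENat.ne_top_iff_exists.1 (ne_top_of_lt (not_le.1 hlt))
    rw [← hm] at hlt
    exact h' m (by exact_mod_cast not_le.1 hlt) (by rw [Within, hm])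

/-- A walk in the graph with an additional edge `s(a, b)` can be assumed to use this edge at most
once. -/
theorem within_sup_edge {a b : V} {n : ℕ} {s t : V}
    (h : Within (G ⊔ SimpleGraph.edge a b) n s t) :
    Within G n s t ∨ (∃ i j, i + j + 1 ≤ n ∧ Within G i s a ∧ Within G j b t) ∨
      ∃ i j, i + j + 1 ≤ n ∧ Within G i s b ∧ Within G j a t := by
  induction n generalizing t with
  | zero => exact Or.inl (within_zero_iff.2 (within_zero_iff.1 h))
  | succ n ih =>
    rcases within_succ_iff.1 h with h | ⟨v, h, hadj⟩
    · rcases ih h with h | ⟨i, j, hij, h⟩ | ⟨i, j, hij, h⟩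
      · exact Or.inl (h.mono n.le_succ)
      · exact Or.inr (Or.inl ⟨i, j, by omega, h⟩)
      · exact Or.inr (Or.inr ⟨i, j, by omega, h⟩)
    · rw [SimpleGraph.sup_adj, SimpleGraph.edge_adj] at hadj
      rcases hadj with hadj | ⟨⟨rfl, rfl⟩ | ⟨rfl, rfl⟩, -⟩
      · rcases ih h with h | ⟨i, j, hij, h, h'⟩ | ⟨i, j, hij, h, h'⟩
        · exact Or.inl (h.trans (Within.of_adj hadj))
        · exact Or.inr (Or.inl ⟨i, j + 1, by omega, h, h'.trans (Within.of_adj hadj)⟩)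
        · exact Or.inr (Or.inr ⟨i, j + 1, by omega, h, h'.trans (Within.of_adj hadj)⟩)
      · rcases ih h with h | ⟨i, j, hij, h, -⟩ | ⟨i, j, hij, h, -⟩
        · exact Or.inr (Or.inl ⟨n, 0, by omega, h, Within.refl _ _⟩)
        · exact Or.inr (Or.inl ⟨i, 0, by omega, h, Within.refl _ _⟩)
        · exact Or.inl (h.mono (by omega))
      · rcases ih h with h | ⟨i, j, hij, h, -⟩ | ⟨i, j, hij, h, -⟩
        · exact Or.inr (Or.inr ⟨n, 0, by omega, h, Within.refl _ _⟩)
        · exact Or.inl (h.mono (by omega))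
        · exact Or.inr (Or.inr ⟨i, 0, by omega, h, Within.refl _ _⟩)

/-- Balls of radius `n` in a graph whose degrees are at most `D` have at most `(D + 1) ^ n`
elements. -/
theorem ncard_within_le [Finite V] {D : ℕ} (hD : ∀ v, {w | G.Adj v w}.ncard ≤ D) (n : ℕ) (u : V) :
    {v | Within G n u v}.ncard ≤ (D + 1) ^ n := by
  induction n with
  | zero =>
    have : {v | Within G 0 u v} = {u} := by
      ext v; simp [within_zero_iff, eq_comm]
    simp [this]
  | succ n ih =>
    classical
    have := Fintype.ofFinite V
    set B : Finset V := Finset.univ.filter fun v => Within G n u v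
    have hB : B.card ≤ (D + 1) ^ n := by
      rw [← Set.ncard_coe_finset]; simpa [B] using ih
    have hsub : {v | Within G (n + 1) u v} ⊆
        ((B.biUnion fun v => insert v (Finset.univ.filter fun w => G.Adj v w) : Finset V) :
          Set V) := by
      intro w hw
      simp only [Finset.coe_biUnion, Set.mem_iUnion, Finset.coe_insert, Set.mem_insert_iff,
        Finset.coe_filter, Finset.mem_univ, true_and, Set.mem_ofPred_eq, B, exists_prop]
      rcases within_succ_iff.1 hw with h | ⟨v, h, hadj⟩
      · exact ⟨w, by simpa using h, Or.inl rfl⟩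
      · exact ⟨v, by simpa using h, Or.inr hadj⟩
    refine (Set.ncard_le_ncard hsub (Finset.finite_toSet _)).trans ?_
    rw [Set.ncard_coe_finset]
    refine (Finset.card_biUnion_le_card_mul _ _ (D + 1) fun v _ => ?_).trans ?_
    · refine (Finset.card_insert_le _ _).trans (Nat.succ_le_succ ?_)
      have := hD v
      rw [← Set.ncard_coe_finset]
      simpa using this
    · rw [pow_succ]
      exact Nat.mul_le_mul_right _ hB

end Within

/-- Each cycle of `G` has length greater than `g`: after the removal of an edge, its ends are at
distance at least `g`. -/
def HighGirth {V : Type*} (G : SimpleGraph V) (g : ℕ) : Prop :=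
  ∀ ⦃a b : V⦄ ⦃n : ℕ⦄, G.Adj a b → Within (G.deleteEdges {s(a, b)}) n a b → g ≤ n

section HighGirth

variable {V : Type*} {G : SimpleGraph V} {g : ℕ}

theorem HighGirth.anti {H : SimpleGraph V} (h : HighGirth G g) (hHG : H ≤ G) : HighGirth H g :=
  fun _ _ _ hadj hw => h (hHG hadj) (hw.mono_graph (SimpleGraph.deleteEdges_mono hHG))

theorem highGirth_bot : HighGirth (⊥ : SimpleGraph V) g :=
  fun _ _ _ hadj => hadj.elim

/-- An edge between two nodes at distance at least `g` closes no cycle of length at most `g`. -/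
theorem HighGirth.sup_edge (h : HighGirth G g) {a b : V} (hab : ∀ n, Within G n a b → g ≤ n) :
    HighGirth (G ⊔ SimpleGraph.edge a b) g := by
  intro c d n hadj hw
  by_cases hcd : s(c, d) = s(a, b)
  · have hle : (G ⊔ SimpleGraph.edge a b).deleteEdges {s(c, d)} ≤ G := by
      intro x y hxy
      rw [SimpleGraph.deleteEdges_adj, SimpleGraph.sup_adj, SimpleGraph.edge_adj, hcd] at hxy
      rcases hxy with ⟨h | h, hne⟩
      · exact h
      · exact absurd (Sym2.eq_iff.2 h.1) hne
    have hw' := hw.mono_graph hle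
    rcases Sym2.eq_iff.1 hcd with ⟨rfl, rfl⟩ | ⟨rfl, rfl⟩
    · exact hab n hw'
    · exact hab n hw'.symm
  · have hadj' : G.Adj c d := by
      rw [SimpleGraph.sup_adj, SimpleGraph.edge_adj] at hadj
      rcases hadj with h | h
      · exact h
      · exact absurd (Sym2.eq_iff.2 h.1) hcd
    have hle : (G ⊔ SimpleGraph.edge a b).deleteEdges {s(c, d)} ≤
        G.deleteEdges {s(c, d)} ⊔ SimpleGraph.edge a b := by
      intro x y hxy
      rw [SimpleGraph.deleteEdges_adj, SimpleGraph.sup_adj] at hxy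
      rw [SimpleGraph.sup_adj, SimpleGraph.deleteEdges_adj]
      tauto
    have hdel : G.deleteEdges {s(c, d)} ≤ G := SimpleGraph.deleteEdges_le _
    have hcd1 : Within G 1 c d := Within.of_adj hadj'
    rcases within_sup_edge (hw.mono_graph hle) with hw | ⟨i, j, hij, h1, h2⟩ | ⟨i, j, hij, h1, h2⟩
    · exact h hadj' hw
    · have := hab _ (((h1.mono_graph hdel).symm.trans hcd1).trans (h2.mono_graph hdel).symm)
      omega
    · have := hab _ (((h2.mono_graph hdel).trans hcd1.symm).trans (h1.mono_graph hdel))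
      omega

end HighGirth

/-! ### Graphs of high girth with prescribed degrees between clusters -/

section Biregular

open Finset

variable {V T : Type*} [Fintype V]

open scoped Classical in
/-- The neighbours of `v` in the cluster `d`. -/
noncomputable def nbrsIn (G : SimpleGraph V) (cl : V → T) (v : V) (d : T) : Finset V :=
  {w | G.Adj v w ∧ cl w = d}

variable {G : SimpleGraph V} {cl : V → T} {dg : T → T → ℕ}

theorem mem_nbrsIn {v w : V} {d : T} : w ∈ nbrsIn G cl v d ↔ G.Adj v w ∧ cl w = d := by
  simp [nbrsIn]

theorem nbrsIn_mono {H : SimpleGraph V} (h : H ≤ G) (v : V) (d : T) :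
    nbrsIn H cl v d ⊆ nbrsIn G cl v d := fun w hw => by
  rw [mem_nbrsIn] at *
  exact ⟨h hw.1, hw.2⟩

/-- Each node of a cluster `c` has at most `dg c d` neighbours in the cluster `d`. -/
def DegreesAtMost (G : SimpleGraph V) (cl : V → T) (dg : T → T → ℕ) : Prop :=
  ∀ v d, (nbrsIn G cl v d).card ≤ dg (cl v) d

theorem nbrsIn_sup_edge_of_ne {a b v : V} (ha : v ≠ a) (hb : v ≠ b) (d : T) :
    nbrsIn (G ⊔ SimpleGraph.edge a b) cl v d = nbrsIn G cl v d := by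
  ext w
  simp [mem_nbrsIn, SimpleGraph.edge_adj, ha, hb]

theorem nbrsIn_sup_edge_of_cluster_ne {a b : V} {d : T} (hd : d ≠ cl b) :
    nbrsIn (G ⊔ SimpleGraph.edge a b) cl a d = nbrsIn G cl a d := by
  ext w
  simp only [mem_nbrsIn, SimpleGraph.edge_adj, SimpleGraph.sup_adj]
  constructor
  · rintro ⟨h | ⟨⟨-, rfl⟩ | ⟨rfl, rfl⟩, h⟩, rfl⟩
    · exact ⟨h, rfl⟩
    · exact absurd rfl hd
    · exact absurd rfl h
  · rintro ⟨h, rfl⟩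
    exact ⟨Or.inl h, rfl⟩

theorem card_nbrsIn_sup_edge_le {a b : V} (d : T) :
    (nbrsIn (G ⊔ SimpleGraph.edge a b) cl a d).card ≤ (nbrsIn G cl a d).card + 1 := by
  classical
  refine (card_le_card (t := insert b (nbrsIn G cl a d)) ?_).trans (card_insert_le _ _)
  intro w
  simp only [mem_nbrsIn, SimpleGraph.edge_adj, SimpleGraph.sup_adj, mem_insert]
  rintro ⟨h | ⟨⟨-, rfl⟩ | ⟨rfl, rfl⟩, h⟩, rfl⟩
  · exact Or.inr ⟨h, rfl⟩
  · exact Or.inl rfl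
  · exact Or.inl rfl

theorem DegreesAtMost.sup_edge (h : DegreesAtMost G cl dg) {a b : V}
    (ha : (nbrsIn G cl a (cl b)).card < dg (cl a) (cl b))
    (hb : (nbrsIn G cl b (cl a)).card < dg (cl b) (cl a)) :
    DegreesAtMost (G ⊔ SimpleGraph.edge a b) cl dg := by
  have key : ∀ {a b : V}, (nbrsIn G cl a (cl b)).card < dg (cl a) (cl b) → ∀ d,
      (nbrsIn (G ⊔ SimpleGraph.edge a b) cl a d).card ≤ dg (cl a) d := by
    intro a b ha d
    by_cases hd : d = cl b
    · subst hd
      exact (card_nbrsIn_sup_edge_le _).trans ha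
    · rw [nbrsIn_sup_edge_of_cluster_ne hd]
      exact h a d
  intro v d
  by_cases hva : v = a
  · subst hva; exact key ha d
  by_cases hvb : v = b
  · subst hvb
    rw [SimpleGraph.edge_comm]
    exact key hb d
  rw [nbrsIn_sup_edge_of_ne hva hvb]
  exact h v d

theorem DegreesAtMost.anti (h : DegreesAtMost G cl dg) {H : SimpleGraph V} (hH : H ≤ G) :
    DegreesAtMost H cl dg :=
  fun v d => (card_le_card (nbrsIn_mono hH v d)).trans (h v d)

theorem card_nbrsIn_deleteEdges_lt {x y : V} (hxy : G.Adj x y) :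
    (nbrsIn (G.deleteEdges {s(x, y)}) cl x (cl y)).card < (nbrsIn G cl x (cl y)).card := by
  refine card_lt_card ⟨nbrsIn_mono (SimpleGraph.deleteEdges_le _) _ _, fun hsub => ?_⟩
  have := hsub (mem_nbrsIn.2 ⟨hxy, rfl⟩)
  simp [mem_nbrsIn] at this

theorem ncard_edgeSet_sup_edge {a b : V} (hab : a ≠ b) (h : ¬ G.Adj a b) :
    (G ⊔ SimpleGraph.edge a b).edgeSet.ncard = G.edgeSet.ncard + 1 := by
  rw [SimpleGraph.edgeSet_sup, SimpleGraph.edgeSet_edge_of_ne hab, Set.union_singleton,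
    Set.ncard_insert_of_notMem (by simpa using h)]

open scoped Classical in
/-- Counting the edges between two clusters from either side. -/
theorem sum_card_nbrsIn_comm (G : SimpleGraph V) (cl : V → T) (c d : T) :
    ∑ u with cl u = c, (nbrsIn G cl u d).card = ∑ v with cl v = d, (nbrsIn G cl v c).card := by
  have := sum_card_bipartiteAbove_eq_sum_card_bipartiteBelow (s := {u | cl u = c})
    (t := {v | cl v = d}) G.Adj
  convert this using 2
  · congr 1; ext w; simp [mem_nbrsIn, bipartiteAbove, and_comm]
  · congr 1; ext w; simp [mem_nbrsIn, bipartiteBelow, and_comm, SimpleGraph.adj_comm]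

open scoped Classical in
/-- A graph of girth greater than `2 * k` which has the greatest number of edges under the
constraint that a node of a cluster `c` has at most `dg c d` neighbours in a cluster `d` has
exactly these numbers of neighbours, if the clusters are large in comparison to the balls of
radius `2 * k - 1`. -/
theorem exists_highGirth_card_nbrsIn_eq {k : ℕ} (hk : 1 ≤ k) (cl : V → T) (dg : T → T → ℕ)
    (hdiag : ∀ c, dg c c = 0)
    (hbal : ∀ c d, #{u | cl u = c} * dg c d = #{v | cl v = d} * dg d c)
    (hball : ∀ G : SimpleGraph V, DegreesAtMost G cl dg → ∀ u v, 0 < dg (cl u) (cl v) →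
      #{x | cl x = cl u ∧ Within G (2 * k - 1) v x} * dg (cl u) (cl v) +
        #{y | cl y = cl v ∧ Within G (2 * k - 1) u y} * dg (cl v) (cl u) <
          #{x | cl x = cl u} * dg (cl u) (cl v)) :
    ∃ G : SimpleGraph V, HighGirth G (2 * k) ∧ ∀ v d, (nbrsIn G cl v d).card = dg (cl v) d := by
  obtain ⟨G, ⟨hcap, hgirth⟩, hmax⟩ := Set.exists_max_image
    {G : SimpleGraph V | DegreesAtMost G cl dg ∧ HighGirth G (2 * k)} (fun G => G.edgeSet.ncard)
    (Set.toFinite _) ⟨⊥, fun v d => by simp [nbrsIn], highGirth_bot⟩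
  refine ⟨G, hgirth, fun u d => ?_⟩
  by_contra hne
  have hu : (nbrsIn G cl u d).card < dg (cl u) d := lt_of_le_of_ne (hcap u d) hne
  set c := cl u with hc
  have hcd : c ≠ d := by
    rintro h
    rw [← h, hdiag] at hu
    omega
  -- As the edges between the two clusters can be counted from either side, the cluster `d`
  -- contains a node with too few neighbours as well.
  obtain ⟨v, rfl, hv⟩ : ∃ v, cl v = d ∧ (nbrsIn G cl v c).card < dg d c := by
    by_contra! hfull
    have h1 : ∑ u with cl u = c, (nbrsIn G cl u d).card < ∑ u with cl u = c, dg c d := by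
      refine sum_lt_sum (fun x hx => ?_) ⟨u, by simp [hc], hu⟩
      have := hcap x d
      rwa [(mem_filter.1 hx).2] at this
    have h2 : ∑ v with cl v = d, dg d c ≤ ∑ v with cl v = d, (nbrsIn G cl v c).card :=
      sum_le_sum fun x hx => hfull x (mem_filter.1 hx).2
    rw [sum_card_nbrsIn_comm] at h1
    simp only [sum_const, smul_eq_mul, hbal c d] at h1 h2
    omega
  -- Two such nodes are close to each other: otherwise an edge could be added.
  have hclose : ∀ u', cl u' = c → (nbrsIn G cl u' (cl v)).card < dg c (cl v) →
      Within G (2 * k - 1) v u' := by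
    intro u' hu' hlt
    by_contra hfar
    have hab : ∀ n, Within G n u' v → 2 * k ≤ n := fun n hn => by
      by_contra hlt
      exact hfar (hn.symm.mono (by omega))
    have hnadj : ¬ G.Adj u' v := fun h => by
      have := hab 1 (Within.of_adj h)
      omega
    have := hmax (G ⊔ SimpleGraph.edge u' v)
      ⟨hcap.sup_edge (by rwa [hu']) (by rwa [hu']), hgirth.sup_edge hab⟩
    rw [ncard_edgeSet_sup_edge (fun h => hcd (by rw [← hu', h])) hnadj] at this
    omega
  have huv := hclose u hc.symm hu
  -- There is an edge between the two clusters that is far away from both nodes.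
  obtain ⟨x, y, hx, hy, hxy, hxv, hyu⟩ : ∃ x y, cl x = c ∧ cl y = cl v ∧ G.Adj x y ∧
      ¬ Within G (2 * k - 1) v x ∧ ¬ Within G (2 * k - 1) u y := by
    by_contra! hnone
    have hcount := card_mul_le_card_mul (s := {x | cl x = c ∧ ¬ Within G (2 * k - 1) v x})
      (t := {y | cl y = cl v ∧ Within G (2 * k - 1) u y}) G.Adj
      (m := dg c (cl v)) (n := dg (cl v) c) ?_ ?_
    · have hsplit : #{x | cl x = c} = #{x | cl x = c ∧ Within G (2 * k - 1) v x} +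
          #{x | cl x = c ∧ ¬ Within G (2 * k - 1) v x} := by
        rw [← card_filter_add_card_filter_not (s := {x | cl x = c})
          (fun x => Within G (2 * k - 1) v x), filter_filter, filter_filter]
      have := hball G hcap u v (Nat.zero_lt_of_lt hu)
      rw [← hc, hsplit, add_mul] at this
      linarith
    · intro x hx
      obtain ⟨hx, hxv⟩ := (mem_filter.1 hx).2
      have hfull : dg c (cl v) ≤ (nbrsIn G cl x (cl v)).card := by
        by_contra hlt
        exact hxv (hclose x hx (by omega))
      refine hfull.trans (card_le_card fun y hy => ?_)
      obtain ⟨hadj, hy⟩ := mem_nbrsIn.1 hy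
      simp only [bipartiteAbove, mem_filter, mem_univ, true_and]
      exact ⟨⟨hy, hnone x y hx hy hadj hxv⟩, hadj⟩
    · intro y hy
      obtain ⟨hy, -⟩ := (mem_filter.1 hy).2
      have := hcap y c
      rw [hy] at this
      refine (card_le_card fun x hx => ?_).trans this
      simp only [bipartiteBelow, mem_filter, mem_univ, true_and] at hx
      exact mem_nbrsIn.2 ⟨hx.2.symm, hx.1.1⟩
  -- This edge is replaced by edges from its ends to `v` and to `u`.
  have hxu : x ≠ u := by rintro rfl; exact hxv huv
  have hyv : y ≠ v := by rintro rfl; exact hyu huv.symm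
  have huy : u ≠ y := by rintro rfl; exact hyu (Within.refl _ _)
  have hxv' : x ≠ v := by rintro rfl; exact hxv (Within.refl _ _)
  have hk2 : 1 ≤ 2 * k - 1 := by omega
  set G₁ := G.deleteEdges {s(x, y)} with hG₁
  have hle : G₁ ≤ G := SimpleGraph.deleteEdges_le _
  set G₂ := G₁ ⊔ SimpleGraph.edge u y with hG₂
  set G₃ := G₂ ⊔ SimpleGraph.edge x v with hG₃
  have hfar : ∀ {a b n}, ¬ Within G (2 * k - 1) a b → Within G n a b → 2 * k ≤ n := by
    intro a b n h hw
    by_contra hlt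
    exact h (hw.mono (by omega))
  have hgirth₂ : HighGirth G₂ (2 * k) := (hgirth.anti hle).sup_edge fun n hn =>
    hfar hyu (hn.mono_graph hle)
  have hgirth₃ : HighGirth G₃ (2 * k) := by
    refine hgirth₂.sup_edge fun n hn => ?_
    rcases within_sup_edge hn with hw | ⟨i, j, hij, h1, h2⟩ | ⟨i, j, hij, h1, h2⟩
    · exact hfar hxv (hw.mono_graph hle).symm
    · have hxy1 : Within G 1 x y := Within.of_adj hxy
      have hi := hfar hyu ((h1.mono_graph hle).symm.trans hxy1)
      have hj := hfar hxv ((hxy1.trans (h2.mono_graph hle)).symm)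
      omega
    · have := hgirth hxy h1
      omega
  have hcap₁ : DegreesAtMost G₁ cl dg := hcap.anti hle
  have hx₁ : (nbrsIn G₁ cl x (cl v)).card < dg c (cl v) := by
    have := (card_nbrsIn_deleteEdges_lt (cl := cl) hxy).trans_le (hcap x (cl y))
    rwa [hx, hy] at this
  have hy₁ : (nbrsIn G₁ cl y c).card < dg (cl v) c := by
    have := (card_nbrsIn_deleteEdges_lt (cl := cl) hxy.symm).trans_le (hcap y (cl x))
    rwa [hx, hy, Sym2.eq_swap] at this
  have hcap₂ : DegreesAtMost G₂ cl dg := by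
    refine hcap₁.sup_edge ?_ ?_
    · rw [hy]
      exact (card_le_card (nbrsIn_mono hle _ _)).trans_lt hu
    · rwa [hy]
  have hcap₃ : DegreesAtMost G₃ cl dg := by
    refine hcap₂.sup_edge ?_ ?_
    · rwa [hG₂, nbrsIn_sup_edge_of_ne hxu hxy.ne, hx]
    · rw [hG₂, nbrsIn_sup_edge_of_ne (fun h => hcd (by rw [hc, h])) hyv.symm, hx]
      exact (card_le_card (nbrsIn_mono hle _ _)).trans_lt hv
  have hcard : G₃.edgeSet.ncard = G.edgeSet.ncard + 1 := by
    rw [hG₃, ncard_edgeSet_sup_edge hxv', hG₂, ncard_edgeSet_sup_edge huy, hG₁,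
      SimpleGraph.edgeSet_deleteEdges, Set.ncard_sdiff_singleton_add_one]
    · simpa using hxy
    · exact fun h => hyu ((Within.of_adj (hle h)).mono hk2)
    · rw [hG₂, SimpleGraph.sup_adj, SimpleGraph.edge_adj]
      rintro (h | ⟨⟨h, -⟩ | ⟨h, -⟩, -⟩)
      · exact hxv ((Within.of_adj (hle h).symm).mono hk2)
      · exact hxu h
      · exact hxy.ne h
  have := hmax G₃ ⟨hcap₃, hgirth₃⟩
  omega

end Biregular

/-! ### The cluster tree -/

/-- The clusters of the cluster tree are words of labels. The word `i :: w` is the child of the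
cluster `w` that is reached by its link with label `i`; seen from the child, this link has the
label `i + 1`. A link with label `i` stands for `δ ^ i` neighbours of each node. The level of a
cluster is the number of the stage, counted from `0`, at which the growing tree acquires it: it is
attached after its parent, and a link with label `i` is available from stage `i + 1` on. -/
def wordLevel : List ℕ → ℕ
  | [] => 0
  | i :: w => max (wordLevel w + 1) (i + 1)

/-- The label of the link from a cluster to its parent, if there is one. -/
def upLabel : List ℕ → Option ℕ
  | [] => none
  | i :: _ => some (i + 1)

/-- The words that are clusters of the tree of order `k`: clusters of level at most `k` have links
with all labels from `0` to `k`, the other ones are leaves of level `k + 1`. -/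
def IsClusterWord (k : ℕ) : List ℕ → Prop
  | [] => True
  | i :: w => IsClusterWord k w ∧ wordLevel w ≤ k ∧ i ≤ k ∧ upLabel w ≠ some i

/-- The cluster `w` has a link with label `i`. -/
def HasLabel (k : ℕ) (w : List ℕ) (i : ℕ) : Prop :=
  upLabel w = some i ∨ wordLevel w ≤ k ∧ i ≤ k

/-- The cluster at the other end of the link of `w` with label `i`. -/
def linkEnd (w : List ℕ) (i : ℕ) : List ℕ :=
  if upLabel w = some i then w.tail else i :: w

/-- The label of the link from `c` to `d`, where one of these two clusters is the parent of the
other one. -/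
def linkLabel (c d : List ℕ) : ℕ :=
  if c.length < d.length then d.headI else c.headI + 1

theorem linkEnd_cons_succ (i : ℕ) (w : List ℕ) : linkEnd (i :: w) (i + 1) = w := by
  simp [linkEnd, upLabel]

theorem linkEnd_of_ne {w : List ℕ} {i : ℕ} (h : upLabel w ≠ some i) : linkEnd w i = i :: w :=
  if_neg h

theorem linkLabel_cons_left (i : ℕ) (w : List ℕ) : linkLabel (i :: w) w = i + 1 := by
  simp [linkLabel]

theorem linkLabel_cons_right (i : ℕ) (w : List ℕ) : linkLabel w (i :: w) = i := by
  simp [linkLabel]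

theorem upLabel_eq_some {w : List ℕ} {i : ℕ} (h : upLabel w = some i) :
    ∃ j w', w = j :: w' ∧ i = j + 1 := by
  cases w with
  | nil => simp [upLabel] at h
  | cons j w' => exact ⟨j, w', rfl, by simpa [upLabel, eq_comm] using h⟩

theorem upLabel_le_wordLevel {w : List ℕ} {i : ℕ} (h : upLabel w = some i) : i ≤ wordLevel w := by
  obtain ⟨j, w', rfl, rfl⟩ := upLabel_eq_some h
  exact le_max_right _ _

theorem linkLabel_linkEnd (w : List ℕ) (i : ℕ) : linkLabel w (linkEnd w i) = i := by
  by_cases h : upLabel w = some i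
  · obtain ⟨j, w', rfl, rfl⟩ := upLabel_eq_some h
    rw [linkEnd_cons_succ, linkLabel_cons_left]
  · rw [linkEnd_of_ne h, linkLabel_cons_right]

theorem linkLabel_linkEnd_le (w : List ℕ) (i : ℕ) : linkLabel (linkEnd w i) w ≤ i + 1 := by
  by_cases h : upLabel w = some i
  · obtain ⟨j, w', rfl, rfl⟩ := upLabel_eq_some h
    rw [linkEnd_cons_succ, linkLabel_cons_right]
    omega
  · rw [linkEnd_of_ne h, linkLabel_cons_left]

theorem wordLevel_linkEnd_le (w : List ℕ) (i : ℕ) :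
    wordLevel (linkEnd w i) ≤ max (wordLevel w) i + 1 := by
  by_cases h : upLabel w = some i
  · obtain ⟨j, w', rfl, rfl⟩ := upLabel_eq_some h
    rw [linkEnd_cons_succ, wordLevel]
    omega
  · rw [linkEnd_of_ne h, wordLevel]
    omega

theorem length_le_wordLevel (w : List ℕ) : w.length ≤ wordLevel w := by
  induction w with
  | nil => exact le_rfl
  | cons i w ih => simp only [wordLevel, List.length_cons]; omega

theorem IsClusterWord.wordLevel_le {k : ℕ} {w : List ℕ} (h : IsClusterWord k w) :
    wordLevel w ≤ k + 1 := by
  cases w with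
  | nil => exact Nat.zero_le _
  | cons i w => obtain ⟨-, h, h', -⟩ := h; simp only [wordLevel]; omega

theorem IsClusterWord.mem_le {k : ℕ} {w : List ℕ} (h : IsClusterWord k w) : ∀ i ∈ w, i ≤ k := by
  induction w with
  | nil => simp
  | cons i w ih =>
    obtain ⟨hw, -, hi, -⟩ := h
    simpa using ⟨hi, ih hw⟩

theorem finite_isClusterWord (k : ℕ) : {w | IsClusterWord k w}.Finite := by
  refine ((List.finite_length_le (Fin (k + 1)) (k + 1)).image (List.map Fin.val)).subset ?_
  intro w hw
  refine ⟨w.attach.map fun i => ⟨i.1, Nat.lt_succ_of_le (IsClusterWord.mem_le hw i.1 i.2)⟩, ?_, ?_⟩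
  · simpa using (length_le_wordLevel w).trans (IsClusterWord.wordLevel_le hw)
  · simp [Function.comp_def]

/-- Two clusters from which the tree looks alike up to distance `r`: either their levels are so
small that no leaf is near, or they are the corresponding descendants of two such clusters, at
equal levels. -/
inductive SimilarClusters (k r : ℕ) : List ℕ → List ℕ → Prop
  | base {c d : List ℕ} (hc : wordLevel c + r ≤ k + 1) (hd : wordLevel d + r ≤ k + 1) :
      SimilarClusters k r c d
  | step {c d : List ℕ} (i : ℕ) (h : SimilarClusters k r c d)
      (hl : wordLevel (i :: c) = wordLevel (i :: d)) : SimilarClusters k r (i :: c) (i :: d)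

/-- A walk that has arrived in a cluster `c` and cannot return by one link with label `s` sees, up
to distance `r`, the same as one that has arrived in `d` and cannot return by one link with
label `t`. The labels are `none` for walks that have not left their start. If the labels are
different, the missing links have to be matched with links of the other cluster, so that their
labels must be small enough for these links not to lead to leaves too early. -/
def SimilarArrivals (k r : ℕ) (c : List ℕ) (s : Option ℕ) (d : List ℕ) (t : Option ℕ) : Prop :=
  SimilarClusters k r c d ∧ (s = t ∨ ∃ i j, s = some i ∧ t = some j ∧ wordLevel c + r ≤ k + 1 ∧
    wordLevel d + r ≤ k + 1 ∧ i + r ≤ k + 1 ∧ j + r ≤ k + 1)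

section Similar

variable {k r : ℕ} {c d : List ℕ}

theorem SimilarClusters.of_succ (h : SimilarClusters k (r + 1) c d) : SimilarClusters k r c d := by
  induction h with
  | base hc hd => exact .base (by omega) (by omega)
  | step i _ hl ih => exact .step i ih hl

theorem SimilarClusters.hasLabel_iff (h : SimilarClusters k (r + 1) c d) (i : ℕ) :
    HasLabel k c i ↔ HasLabel k d i := by
  cases h with
  | base hc hd =>
    have key : ∀ {w : List ℕ}, wordLevel w + (r + 1) ≤ k + 1 → (HasLabel k w i ↔ i ≤ k) := by
      intro w hw
      refine ⟨?_, fun hi => Or.inr ⟨by omega, hi⟩⟩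
      rintro (h | ⟨-, h⟩)
      · have := upLabel_le_wordLevel h
        omega
      · exact h
    rw [key hc, key hd]
  | step j h hl => simp only [HasLabel, upLabel, hl]

theorem similarArrivals_linkEnd_of_le {i j : ℕ} (hc : wordLevel c + (r + 1) ≤ k + 1)
    (hd : wordLevel d + (r + 1) ≤ k + 1) (hi : i + (r + 1) ≤ k + 1) (hj : j + (r + 1) ≤ k + 1) :
    SimilarArrivals k r (linkEnd c i) (some (linkLabel (linkEnd c i) c))
      (linkEnd d j) (some (linkLabel (linkEnd d j) d)) := by
  have h1 := wordLevel_linkEnd_le c i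
  have h2 := wordLevel_linkEnd_le d j
  have h3 := linkLabel_linkEnd_le c i
  have h4 := linkLabel_linkEnd_le d j
  have h5 : wordLevel (linkEnd c i) + r ≤ k + 1 := by omega
  have h6 : wordLevel (linkEnd d j) + r ≤ k + 1 := by omega
  exact ⟨.base h5 h6, Or.inr ⟨_, _, rfl, rfl, h5, h6, by omega, by omega⟩⟩

/-- Links with equal labels lead from similar clusters to similar arrivals. -/
theorem SimilarClusters.similarArrivals_linkEnd (h : SimilarClusters k (r + 1) c d) (i : ℕ) :
    SimilarArrivals k r (linkEnd c i) (some (linkLabel (linkEnd c i) c))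
      (linkEnd d i) (some (linkLabel (linkEnd d i) d)) := by
  have h' := h.of_succ
  cases h with
  | base hc hd =>
    by_cases hi : i + (r + 1) ≤ k + 1
    · exact similarArrivals_linkEnd_of_le hc hd hi hi
    · -- The label exceeds both levels, so that both links lead to children of level `i + 1`.
      have hc' : upLabel c ≠ some i := fun h => by have := upLabel_le_wordLevel h; omega
      have hd' : upLabel d ≠ some i := fun h => by have := upLabel_le_wordLevel h; omega
      rw [linkEnd_of_ne hc', linkEnd_of_ne hd', linkLabel_cons_left, linkLabel_cons_left]
      exact ⟨.step i h' (by simp only [wordLevel]; omega), Or.inl rfl⟩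
  | step j h hl =>
    by_cases hi : i = j + 1
    · subst hi
      simp only [linkEnd_cons_succ, linkLabel_cons_right]
      exact ⟨h.of_succ, Or.inl rfl⟩
    · have hne : ∀ w, upLabel (j :: w) ≠ some i := fun w h =>
        hi (by simpa [upLabel, eq_comm] using h)
      rw [linkEnd_of_ne (hne _), linkEnd_of_ne (hne _), linkLabel_cons_left, linkLabel_cons_left]
      exact ⟨.step i h' (by simp only [wordLevel] at hl ⊢; omega), Or.inl rfl⟩

end Similar

/-! ### Graphs of high girth are trees locally -/

/-- `φ` maps the `k`-hop neighbourhood of `u` to the one of `v` in such a way that the two nodes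
have the same unlabelled view after `k` rounds. -/
structure IsViewIso {V : Type*} (G : SimpleGraph V) (k : ℕ) (u v : V) (φ : V → V) : Prop where
  map_root : φ u = v
  edist_eq : ∀ z, Within G k u z → G.edist v (φ z) = G.edist u z
  injOn : Set.InjOn φ {z | Within G k u z}
  surj : ∀ y, Within G k v y → ∃ z, Within G k u z ∧ φ z = y
  adj_iff : ∀ a b, Within G k u a → Within G k u b → ¬ (G.edist u a = k ∧ G.edist u b = k) →
    (G.Adj (φ a) (φ b) ↔ G.Adj a b)

section LocalTree

variable {V : Type*} {G : SimpleGraph V}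

theorem exists_adj_edist_eq {n : ℕ} {u y : V} (h : G.edist u y = (n + 1 : ℕ)) :
    ∃ z, G.Adj y z ∧ G.edist u z = n := by
  obtain ⟨h1, h2⟩ := edist_eq_coe_iff.1 h
  rcases within_succ_iff.1 h1 with h | ⟨z, hz, hadj⟩
  · exact absurd h (h2 n n.lt_succ_self)
  · refine ⟨z, hadj.symm, edist_eq_coe_iff.2 ⟨hz, fun m hm hw => ?_⟩⟩
    exact h2 (m + 1) (by omega) (hw.trans (Within.of_adj hadj))

theorem Within.exists_edist_eq {n : ℕ} {u y : V} (h : Within G n u y) :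
    ∃ m ≤ n, G.edist u y = (m : ℕ) := by
  obtain ⟨m, hm⟩ := ENat.ne_top_iff_exists.1 (ne_top_of_le_ne_top (ENat.natCast_ne_top n) h)
  refine ⟨m, ?_, hm.symm⟩
  rw [Within, ← hm] at h
  exact_mod_cast h

theorem edist_eq_of_adj {n : ℕ} {u z y : V} (h : G.edist u z = (n : ℕ)) (hadj : G.Adj z y) :
    ∃ m : ℕ, G.edist u y = m ∧ m ≤ n + 1 ∧ n ≤ m + 1 := by
  obtain ⟨h1, h2⟩ := edist_eq_coe_iff.1 h
  obtain ⟨m, hm, hy⟩ := (h1.trans (Within.of_adj hadj)).exists_edist_eq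
  refine ⟨m, hy, hm, ?_⟩
  by_contra hlt
  exact h2 (m + 1) (by omega) ((edist_eq_coe_iff.1 hy).1.trans (Within.of_adj hadj.symm))

/-- A shortest walk of length `n` does not use an edge whose ends both are at distance at least
`n` from its start. -/
theorem Within.deleteEdges {n : ℕ} {u a x y : V} (h : Within G n u a)
    (hx : ∀ m < n, ¬ Within G m u x) (hy : ∀ m < n, ¬ Within G m u y) :
    Within (G.deleteEdges {s(x, y)}) n u a := by
  induction n generalizing a with
  | zero => exact within_zero_iff.2 (within_zero_iff.1 h)
  | succ n ih =>
    have ih := fun {a} (h : Within G n u a) =>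
      ih h (fun m hm => hx m (by omega)) (fun m hm => hy m (by omega))
    refine within_succ_iff.2 ?_
    rcases within_succ_iff.1 h with h | ⟨v, hv, hadj⟩
    · exact Or.inl (ih h)
    · refine Or.inr ⟨v, ih hv, SimpleGraph.deleteEdges_adj.2 ⟨hadj, fun he => ?_⟩⟩
      rcases Sym2.eq_iff.1 he with ⟨rfl, -⟩ | ⟨rfl, -⟩
      · exact hx n n.lt_succ_self hv
      · exact hy n n.lt_succ_self hv

theorem HighGirth.not_adj_of_edist_eq {k n : ℕ} (hG : HighGirth G (2 * k)) {u z z' : V}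
    (hn : n < k) (hz : G.edist u z = (n : ℕ)) (hz' : G.edist u z' = (n : ℕ)) : ¬ G.Adj z z' := by
  intro hadj
  obtain ⟨h1, h2⟩ := edist_eq_coe_iff.1 hz
  obtain ⟨h1', h2'⟩ := edist_eq_coe_iff.1 hz'
  have := hG hadj ((h1.deleteEdges h2 h2').symm.trans (h1'.deleteEdges h2 h2'))
  omega

theorem HighGirth.eq_of_adj_of_edist_eq {k n : ℕ} (hG : HighGirth G (2 * k)) {u y z z' : V}
    (hn : n < k) (hy : G.edist u y = (n + 1 : ℕ)) (hz : G.edist u z = (n : ℕ))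
    (hz' : G.edist u z' = (n : ℕ)) (h : G.Adj y z) (h' : G.Adj y z') : z = z' := by
  by_contra hne
  obtain ⟨h1, h2⟩ := edist_eq_coe_iff.1 hz
  obtain ⟨h1', h2'⟩ := edist_eq_coe_iff.1 hz'
  have hy2 : ∀ m < n, ¬ Within G m u y := fun m hm => (edist_eq_coe_iff.1 hy).2 m (by omega)
  have hadj : (G.deleteEdges {s(z, y)}).Adj z' y := by
    refine SimpleGraph.deleteEdges_adj.2 ⟨h'.symm, fun he => ?_⟩
    rcases Sym2.eq_iff.1 he with ⟨rfl, -⟩ | ⟨rfl, -⟩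
    · exact hne rfl
    · exact h'.ne rfl
  have := hG h.symm (((h1.deleteEdges h2 hy2).symm.trans (h1'.deleteEdges h2 hy2)).trans
    (Within.of_adj hadj))
  omega

open scoped Classical in
/-- The last node before `z` on a shortest walk from `u`; the junk value at `u` is `u`. -/
noncomputable def parentFrom (G : SimpleGraph V) (u z : V) : V :=
  if h : ∃ p, ∃ n : ℕ, G.Adj z p ∧ G.edist u p = n ∧ G.edist u z = (n + 1 : ℕ) then h.choose else z

theorem parentFrom_spec {n : ℕ} {u y : V} (h : G.edist u y = (n + 1 : ℕ)) :
    G.Adj y (parentFrom G u y) ∧ G.edist u (parentFrom G u y) = n := by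
  have hex : ∃ p, ∃ n : ℕ, G.Adj y p ∧ G.edist u p = n ∧ G.edist u y = (n + 1 : ℕ) := by
    obtain ⟨z, hz⟩ := exists_adj_edist_eq h
    exact ⟨z, n, hz.1, hz.2, h⟩
  rw [parentFrom, dif_pos hex]
  obtain ⟨m, h1, h2, h3⟩ := hex.choose_spec
  refine ⟨h1, ?_⟩
  have hmn : ((m + 1 : ℕ) : ℕ∞) = (n + 1 : ℕ) := h3.symm.trans h
  have : m = n := by
    have : m + 1 = n + 1 := by exact_mod_cast hmn
    omega
  rwa [this] at h2

theorem HighGirth.parentFrom_eq {k n : ℕ} (hG : HighGirth G (2 * k)) {u y z : V}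
    (hn : n < k) (hy : G.edist u y = (n + 1 : ℕ)) (hz : G.edist u z = (n : ℕ)) (h : G.Adj y z) :
    parentFrom G u y = z :=
  hG.eq_of_adj_of_edist_eq hn hy (parentFrom_spec hy).2 hz (parentFrom_spec hy).1 h

/-- The neighbours of `z` that are at distance `n + 1` from `u`, where `z` is meant to be at
distance `n`. -/
def childrenFrom (G : SimpleGraph V) (u : V) (n : ℕ) (z : V) : Set V :=
  {y | G.Adj z y ∧ G.edist u y = (n + 1 : ℕ)}

theorem childrenFrom_self (G : SimpleGraph V) (u : V) : childrenFrom G u 0 u = G.neighborSet u := by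
  ext y
  simp [childrenFrom]

theorem HighGirth.childrenFrom_eq {k n : ℕ} (hG : HighGirth G (2 * k)) {u z : V} (hn : n + 1 < k)
    (hz : G.edist u z = (n + 1 : ℕ)) :
    childrenFrom G u (n + 1) z = G.neighborSet z \ {parentFrom G u z} := by
  ext y
  simp only [childrenFrom, SimpleGraph.mem_neighborSet, Set.mem_sdiff, Set.mem_singleton_iff,
    Set.mem_ofPred_eq]
  refine and_congr_right fun hadj => ⟨?_, fun hne => ?_⟩
  · rintro hy rfl
    rw [(parentFrom_spec hz).2] at hy
    have : n = n + 1 + 1 := by exact_mod_cast hy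
    omega
  · obtain ⟨m, hm, h1, h2⟩ := edist_eq_of_adj hz hadj
    obtain rfl | rfl | rfl : m = n ∨ m = n + 1 ∨ m = n + 2 := by omega
    · exact absurd (hG.parentFrom_eq (by omega) hz hm hadj).symm hne
    · exact absurd hadj (hG.not_adj_of_edist_eq hn hz hm)
    · exact hm

end LocalTree

/-! ### Nodes with equal views -/

/-- The nodes of `G` are assigned to clusters of the cluster tree, and a node has `δ ^ i`
neighbours in the cluster that is reached by the link with label `i`. -/
structure IsClusterGraph {V : Type*} [Fintype V] (G : SimpleGraph V) (k δ : ℕ)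
    (cl : V → List ℕ) : Prop where
  hasLabel : ∀ u y, G.Adj u y → HasLabel k (cl u) (linkLabel (cl u) (cl y))
  linkEnd_linkLabel : ∀ u y, G.Adj u y → linkEnd (cl u) (linkLabel (cl u) (cl y)) = cl y
  card_nbrsIn : ∀ u i, HasLabel k (cl u) i → (nbrsIn G cl u (linkEnd (cl u) i)).card = δ ^ i

open scoped Classical in
/-- The label of the link from the cluster of `z` to the cluster of the node before `z` on a
shortest walk from `u`, and `none` for `z = u`. -/
noncomputable def backLabel {V : Type*} (G : SimpleGraph V) (cl : V → List ℕ) (u z : V) :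
    Option ℕ :=
  if z = u then none else some (linkLabel (cl z) (cl (parentFrom G u z)))

section ViewIso

variable {V : Type*} [Fintype V] {G : SimpleGraph V} {k δ : ℕ} {cl : V → List ℕ}

theorem IsClusterGraph.card_label (hG : IsClusterGraph G k δ cl) (z : V) (i : ℕ)
    (hi : HasLabel k (cl z) i) :
    Nat.card {y : G.neighborSet z // linkLabel (cl z) (cl y) = i} = δ ^ i := by
  rw [← hG.card_nbrsIn z i hi, ← Fintype.card_coe, ← Nat.card_eq_fintype_card]
  refine Nat.card_congr
    { toFun := fun y => ⟨y.1.1, mem_nbrsIn.2 ⟨y.1.2, ?_⟩⟩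
      invFun := fun y => ⟨⟨y.1, (mem_nbrsIn.1 y.2).1⟩, ?_⟩
      left_inv := fun y => rfl
      right_inv := fun y => rfl }
  · have h := hG.linkEnd_linkLabel z y.1.1 y.1.2
    rw [y.2] at h
    exact h.symm
  · rw [(mem_nbrsIn.1 y.2).2, linkLabel_linkEnd]

/-- Between the neighbourhoods of two nodes with links of the same labels there is a bijection that
preserves the labels. -/
theorem IsClusterGraph.exists_bijOn_neighborSet (hG : IsClusterGraph G k δ cl) {z z' : V}
    (h : ∀ i, HasLabel k (cl z) i ↔ HasLabel k (cl z') i) :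
    ∃ f : V → V, Set.BijOn f (G.neighborSet z) (G.neighborSet z') ∧
      ∀ y, G.Adj z y → linkLabel (cl z') (cl (f y)) = linkLabel (cl z) (cl y) := by
  classical
  have hcard : ∀ i, Nat.card {y : G.neighborSet z // linkLabel (cl z) (cl y) = i} =
      Nat.card {y : G.neighborSet z' // linkLabel (cl z') (cl y) = i} := by
    intro i
    by_cases hi : HasLabel k (cl z) i
    · rw [hG.card_label z i hi, hG.card_label z' i ((h i).1 hi)]
    · have h1 : IsEmpty {y : G.neighborSet z // linkLabel (cl z) (cl y) = i} :=
        ⟨fun y => hi (y.2 ▸ hG.hasLabel z y y.1.2)⟩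
      have h2 : IsEmpty {y : G.neighborSet z' // linkLabel (cl z') (cl y) = i} :=
        ⟨fun y => hi ((h i).2 (y.2 ▸ hG.hasLabel z' y y.1.2))⟩
      simp
  have e := fun i => (Finite.card_eq.1 (hcard i)).some
  set E : G.neighborSet z ≃ G.neighborSet z' := Equiv.ofFiberEquiv e with hE
  have hEl : ∀ y, linkLabel (cl z') (cl (E y)) = linkLabel (cl z) (cl y) := fun y =>
    Equiv.ofFiberEquiv_map e y
  refine ⟨fun y => if hy : G.Adj z y then E ⟨y, hy⟩ else y, ⟨?_, ?_, ?_⟩, ?_⟩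
  · intro y hy
    simp only [SimpleGraph.mem_neighborSet] at hy
    simp only [hy, dite_true]
    exact (E ⟨y, hy⟩).2
  · intro a ha b hb hab
    simp only [SimpleGraph.mem_neighborSet] at ha hb
    simp only [ha, hb, dite_true] at hab
    exact congrArg Subtype.val (E.injective (Subtype.ext hab))
  · intro y hy
    refine ⟨E.symm ⟨y, hy⟩, (E.symm ⟨y, hy⟩).2, ?_⟩
    have : G.Adj z (E.symm ⟨y, hy⟩) := (E.symm ⟨y, hy⟩).2
    simp only [this, dite_true]
    exact congrArg Subtype.val (E.apply_symm_apply ⟨y, hy⟩)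
  · intro y hy
    simpa [hy] using hEl ⟨y, hy⟩

/-- Similar arrivals have matching children, which are similar arrivals at a distance smaller
by one. -/
theorem IsClusterGraph.exists_bijOn_childrenFrom (hG : IsClusterGraph G k δ cl)
    (hgirth : HighGirth G (2 * k)) {n : ℕ} (hn : n < k) {u v z z' : V}
    (hz : G.edist u z = (n : ℕ)) (hz' : G.edist v z' = (n : ℕ))
    (hs : SimilarArrivals k (k - n) (cl z) (backLabel G cl u z) (cl z') (backLabel G cl v z')) :
    ∃ f : V → V, Set.BijOn f (childrenFrom G u n z) (childrenFrom G v n z') ∧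
      ∀ y ∈ childrenFrom G u n z,
        SimilarArrivals k (k - (n + 1)) (cl y) (backLabel G cl u y)
          (cl (f y)) (backLabel G cl v (f y)) := by
  classical
  obtain ⟨r, hr⟩ : ∃ r, k - n = r + 1 := ⟨k - n - 1, by omega⟩
  have hr' : k - (n + 1) = r := by omega
  rw [hr] at hs
  rw [hr']
  have hback : ∀ {u z y : V}, G.edist u z = (n : ℕ) → y ∈ childrenFrom G u n z →
      backLabel G cl u y = some (linkLabel (linkEnd (cl z) (linkLabel (cl z) (cl y))) (cl z)) := by
    intro u z y hz hy
    have hne : y ≠ u := by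
      rintro rfl
      have := hy.2
      rw [SimpleGraph.edist_self] at this
      exact absurd this.symm (by simp)
    rw [backLabel, if_neg hne, hgirth.parentFrom_eq hn hy.2 hz hy.1.symm,
      hG.linkEnd_linkLabel z y hy.1]
  obtain ⟨f, hf, hlab⟩ := hG.exists_bijOn_neighborSet hs.1.hasLabel_iff
  cases n with
  | zero =>
    obtain rfl : u = z := by simpa using hz
    obtain rfl : v = z' := by simpa using hz'
    rw [childrenFrom_self, childrenFrom_self]
    refine ⟨f, hf, fun y hy => ?_⟩
    have hfy := hf.mapsTo hy
    rw [hback hz (childrenFrom_self G u ▸ hy), hback hz' (childrenFrom_self G v ▸ hfy), hlab y hy]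
    have := hs.1.similarArrivals_linkEnd (linkLabel (cl u) (cl y))
    rwa [hG.linkEnd_linkLabel u y hy, ← hlab y hy, hG.linkEnd_linkLabel v (f y) hfy] at this ⊢
  | succ n =>
    set p := parentFrom G u z with hp
    set p' := parentFrom G v z' with hp'
    have hpz : G.Adj z p := (parentFrom_spec hz).1
    have hpz' : G.Adj z' p' := (parentFrom_spec hz').1
    have hzu : z ≠ u := by
      rintro rfl
      rw [SimpleGraph.edist_self] at hz
      exact absurd hz.symm (by simp)
    have hzv : z' ≠ v := by
      rintro rfl
      rw [SimpleGraph.edist_self] at hz'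
      exact absurd hz'.symm (by simp)
    rw [backLabel, backLabel, if_neg hzu, if_neg hzv, ← hp, ← hp'] at hs
    -- The bijection is corrected such that it maps the parent of `z` to the one of `z'`.
    set σ := Equiv.swap (f p) p' with hσ
    have hσbij : Set.BijOn σ (G.neighborSet z') (G.neighborSet z') := by
      have hmaps : Set.MapsTo σ (G.neighborSet z') (G.neighborSet z') := by
        intro y hy
        rw [hσ, Equiv.swap_apply_def]
        split_ifs
        exacts [hpz', hf.mapsTo hpz, hy]
      exact ⟨hmaps, σ.injective.injOn,
        fun y hy => ⟨σ y, hmaps hy, Equiv.congr_fun (Equiv.swap_swap _ _) y⟩⟩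
    have hbij : Set.BijOn (σ ∘ f) (childrenFrom G u (n + 1) z) (childrenFrom G v (n + 1) z') := by
      have := (hσbij.comp hf).sdiff_singleton (a := p) hpz
      rw [hgirth.childrenFrom_eq hn hz, hgirth.childrenFrom_eq hn hz', ← hp, ← hp']
      simpa [hσ] using this
    refine ⟨σ ∘ f, hbij, fun y hy => ?_⟩
    have hgy := hbij.mapsTo hy
    rw [hback hz hy, hback hz' hgy]
    have key : SimilarArrivals k r (linkEnd (cl z) (linkLabel (cl z) (cl y)))
        (some (linkLabel (linkEnd (cl z) (linkLabel (cl z) (cl y))) (cl z)))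
        (linkEnd (cl z') (linkLabel (cl z') (cl ((σ ∘ f) y))))
        (some (linkLabel (linkEnd (cl z') (linkLabel (cl z') (cl ((σ ∘ f) y)))) (cl z'))) := by
      by_cases heq : linkLabel (cl z') (cl ((σ ∘ f) y)) = linkLabel (cl z) (cl y)
      · rw [heq]
        exact hs.1.similarArrivals_linkEnd _
      · have hyp : y ≠ p := by
          rintro rfl
          have := (hgirth.childrenFrom_eq hn hz ▸ hy).2
          exact this rfl
        have hfy : f y ≠ f p := fun h => hyp (hf.injOn hy.1 hpz h)
        have hfp : f y = p' := by
          by_contra hne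
          apply heq
          rw [Function.comp_apply, hσ, Equiv.swap_apply_of_ne_of_ne hfy hne, hlab y hy.1]
        have h1 : linkLabel (cl z) (cl y) = linkLabel (cl z') (cl p') := by
          rw [← hlab y hy.1, hfp]
        have h2 : linkLabel (cl z') (cl ((σ ∘ f) y)) = linkLabel (cl z) (cl p) := by
          rw [← hlab p hpz, Function.comp_apply, hfp, hσ, Equiv.swap_apply_right]
        rw [h1, h2] at heq ⊢
        rcases hs.2 with h | ⟨i, j, hi, hj, h3, h4, h5, h6⟩
        · exact absurd (Option.some.inj h) heq
        · rw [Option.some.inj hi, Option.some.inj hj]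
          exact similarArrivals_linkEnd_of_le h3 h4 h6 h5
    rwa [hG.linkEnd_linkLabel z y hy.1, hG.linkEnd_linkLabel z' _ hgy.1] at key ⊢

/-- The bijection between the views is extended from distance `n` to distance `n + 1`, where all
nodes have a unique parent. -/
theorem IsClusterGraph.exists_isViewIso_aux (hG : IsClusterGraph G k δ cl)
    (hgirth : HighGirth G (2 * k)) {u v : V} (huv : SimilarClusters k k (cl u) (cl v)) (n : ℕ)
    (hn : n ≤ k) :
    ∃ φ, IsViewIso G n u v φ ∧ ∀ z, G.edist u z = (n : ℕ) →
      SimilarArrivals k (k - n) (cl z) (backLabel G cl u z)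
        (cl (φ z)) (backLabel G cl v (φ z)) := by
  induction n with
  | zero =>
    refine ⟨fun _ => v, ⟨rfl, ?_, ?_, ?_, ?_⟩, ?_⟩
    · intro z hz
      rw [← within_zero_iff.1 hz]
      simp
    · intro a ha b hb _
      exact (within_zero_iff.1 ha).symm.trans (within_zero_iff.1 hb)
    · intro y hy
      exact ⟨u, Within.refl _ _, within_zero_iff.1 hy⟩
    · intro a b ha hb _
      rw [← within_zero_iff.1 ha, ← within_zero_iff.1 hb]
      simp
    · intro z hz
      obtain rfl : u = z := by simpa using hz
      exact ⟨huv, Or.inl (by simp [backLabel])⟩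
  | succ n ih =>
    obtain ⟨φ, hφ, hsim⟩ := ih (by omega)
    have hnk : n < k := by omega
    have hφz : ∀ {z m}, m ≤ n → G.edist u z = (m : ℕ) → G.edist v (φ z) = (m : ℕ) :=
      fun {z m} hm hz => (hφ.edist_eq z ((edist_eq_coe_iff.1 hz).1.mono hm)).trans hz
    have hstep : ∀ z, G.edist u z = (n : ℕ) → ∃ f : V → V,
        Set.BijOn f (childrenFrom G u n z) (childrenFrom G v n (φ z)) ∧
        ∀ y ∈ childrenFrom G u n z, SimilarArrivals k (k - (n + 1)) (cl y) (backLabel G cl u y)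
          (cl (f y)) (backLabel G cl v (f y)) := fun z hz =>
      hG.exists_bijOn_childrenFrom hgirth hnk hz (hφz le_rfl hz) (hsim z hz)
    choose! f hf hfsim using hstep
    classical
    set ψ : V → V := fun y => if G.edist u y = (n + 1 : ℕ) then f (parentFrom G u y) y else φ y
      with hψ
    have hold : ∀ {y m}, m ≤ n → G.edist u y = (m : ℕ) → ψ y = φ y := by
      intro y m hm hy
      rw [hψ]
      refine if_neg fun h => ?_
      have h' : ((m : ℕ) : ℕ∞) = (n + 1 : ℕ) := hy.symm.trans h
      have : m = n + 1 := by exact_mod_cast h'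
      omega
    have hnew : ∀ {y}, G.edist u y = (n + 1 : ℕ) → ψ y = f (parentFrom G u y) y :=
      fun h => if_pos h
    have hchild : ∀ {y}, G.edist u y = (n + 1 : ℕ) →
        ψ y ∈ childrenFrom G v n (φ (parentFrom G u y)) := by
      intro y hy
      rw [hnew hy]
      exact (hf _ (parentFrom_spec hy).2).mapsTo ⟨(parentFrom_spec hy).1.symm, hy⟩
    have hparent : ∀ {y}, G.edist u y = (n + 1 : ℕ) →
        parentFrom G v (ψ y) = φ (parentFrom G u y) := fun {y} hy =>
      hgirth.parentFrom_eq hnk (hchild hy).2 (hφz le_rfl (parentFrom_spec hy).2) (hchild hy).1.symm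
    have hdist : ∀ {z m}, m ≤ n + 1 → G.edist u z = (m : ℕ) → G.edist v (ψ z) = (m : ℕ) := by
      intro z m hm hz
      rcases hm.lt_or_eq with hm | rfl
      · rw [hold (by omega) hz]
        exact hφz (by omega) hz
      · exact (hchild hz).2
    have hinjφ : ∀ {a b m}, m ≤ n → G.edist u a = (m : ℕ) → G.edist u b = (m : ℕ) →
        φ a = φ b → a = b := fun hm ha hb h =>
      hφ.injOn ((edist_eq_coe_iff.1 ha).1.mono hm) ((edist_eq_coe_iff.1 hb).1.mono hm) h
    -- The adjacency of a node at distance `m ≤ n` and a node at distance `n + 1`.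
    have hadj : ∀ {a b m}, m ≤ n → G.edist u a = (m : ℕ) → G.edist u b = (n + 1 : ℕ) →
        (G.Adj (ψ a) (ψ b) ↔ G.Adj a b) := by
      intro a b m hm ha hb
      have ha' := hφz hm ha
      rw [hold hm ha]
      rcases hm.lt_or_eq with hm | rfl
      · have hfar : ∀ {w x y : V}, G.edist w x = (m : ℕ) → G.edist w y = (n + 1 : ℕ) →
            ¬ G.Adj x y := by
          intro w x y hx hy hadj
          obtain ⟨m', h1, h2, -⟩ := edist_eq_of_adj hx hadj
          have h3 : ((m' : ℕ) : ℕ∞) = (n + 1 : ℕ) := h1.symm.trans hy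
          have : m' = n + 1 := by exact_mod_cast h3
          omega
        exact iff_of_false (hfar ha' (hchild hb).2) (hfar ha hb)
      · constructor
        · intro h
          have h1 := hgirth.parentFrom_eq hnk (hchild hb).2 ha' h.symm
          rw [hparent hb] at h1
          rw [← hinjφ le_rfl (parentFrom_spec hb).2 ha h1]
          exact (parentFrom_spec hb).1.symm
        · intro h
          have h1 := hgirth.parentFrom_eq hnk hb ha h.symm
          rw [← h1]
          exact (hchild hb).1
    refine ⟨ψ, ⟨?_, ?_, ?_, ?_, ?_⟩, ?_⟩
    · rw [hold (m := 0) (by omega) (by simp), hφ.map_root]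
    · intro z hz
      obtain ⟨m, hm, hz⟩ := Within.exists_edist_eq hz
      rw [hdist hm hz, hz]
    · intro a ha b hb hab
      obtain ⟨m, hm, ha⟩ := Within.exists_edist_eq ha
      obtain ⟨m', hm', hb⟩ := Within.exists_edist_eq hb
      obtain rfl : m = m' := by
        have h1 := hdist hm ha
        rw [hab, hdist hm' hb] at h1
        exact_mod_cast h1.symm
      rcases hm.lt_or_eq with hm | rfl
      · rw [hold (by omega) ha, hold (by omega) hb] at hab
        exact hinjφ (by omega) ha hb hab
      · have hpar : parentFrom G u a = parentFrom G u b := by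
          refine hinjφ le_rfl (parentFrom_spec ha).2 (parentFrom_spec hb).2 ?_
          rw [← hparent ha, ← hparent hb, hab]
        rw [hnew ha, hnew hb, ← hpar] at hab
        refine (hf _ (parentFrom_spec ha).2).injOn ⟨(parentFrom_spec ha).1.symm, ha⟩
          ⟨?_, hb⟩ hab
        rw [hpar]
        exact (parentFrom_spec hb).1.symm
    · intro y hy
      obtain ⟨m, hm, hy⟩ := Within.exists_edist_eq hy
      rcases hm.lt_or_eq with hm | rfl
      · obtain ⟨z, hz, hzy⟩ := hφ.surj y ((edist_eq_coe_iff.1 hy).1.mono (by omega))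
        obtain ⟨m', hm', hz'⟩ := hz.exists_edist_eq
        exact ⟨z, hz.mono n.le_succ, by rw [hold hm' hz', hzy]⟩
      · obtain ⟨hadj', hp⟩ := parentFrom_spec hy
        obtain ⟨z, hz, hzp⟩ := hφ.surj _ (edist_eq_coe_iff.1 hp).1
        have hz' : G.edist u z = (n : ℕ) := by rw [← hφ.edist_eq z hz, hzp, hp]
        obtain ⟨w, hw, hwy⟩ := (hf z hz').surjOn (show y ∈ childrenFrom G v n (φ z) from
          ⟨by rw [hzp]; exact hadj'.symm, hy⟩)
        refine ⟨w, (edist_eq_coe_iff.1 hw.2).1, ?_⟩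
        rw [hnew hw.2, hgirth.parentFrom_eq hnk hw.2 hz' hw.1.symm, hwy]
    · intro a b ha hb hne
      obtain ⟨m, hm, ha⟩ := Within.exists_edist_eq ha
      obtain ⟨m', hm', hb⟩ := Within.exists_edist_eq hb
      rcases hm.lt_or_eq with hm | rfl
      · rcases hm'.lt_or_eq with hm' | rfl
        · by_cases hmm : m = n ∧ m' = n
          · rw [hmm.1] at ha
            rw [hmm.2] at hb
            exact iff_of_false (hgirth.not_adj_of_edist_eq hnk (hdist (by omega) ha)
              (hdist (by omega) hb)) (hgirth.not_adj_of_edist_eq hnk ha hb)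
          · rw [hold (by omega) ha, hold (by omega) hb]
            refine hφ.adj_iff a b ((edist_eq_coe_iff.1 ha).1.mono (by omega))
              ((edist_eq_coe_iff.1 hb).1.mono (by omega)) ?_
            rw [ha, hb]
            rintro ⟨h1, h2⟩
            exact hmm ⟨by exact_mod_cast h1, by exact_mod_cast h2⟩
        · exact hadj (by omega) ha hb
      · rcases hm'.lt_or_eq with hm' | rfl
        · rw [G.adj_comm, G.adj_comm a]
          exact hadj (by omega) hb ha
        · exact absurd ⟨ha, hb⟩ hne
    · intro y hy
      rw [hnew hy]
      exact hfsim _ (parentFrom_spec hy).2 y ⟨(parentFrom_spec hy).1.symm, hy⟩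

/-- In a cluster graph of girth greater than `2 * k`, the nodes of the root of the cluster tree and
those of its child with label `0` have the same views after `k` rounds. -/
theorem IsClusterGraph.exists_isViewIso (hG : IsClusterGraph G k δ cl)
    (hgirth : HighGirth G (2 * k)) {u v : V} (hu : cl u = []) (hv : cl v = [0]) :
    ∃ φ, IsViewIso G k u v φ := by
  obtain ⟨φ, hφ, -⟩ := hG.exists_isViewIso_aux hgirth (u := u) (v := v)
    (by rw [hu, hv]; exact .base (by simp only [wordLevel]; omega) (by simp [wordLevel]; omega))
    k le_rfl
  exact ⟨φ, hφ⟩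

end ViewIso

/-! ### Nodes attached to edges -/

/-- The graph `G` with an additional node for each orientation of each edge, which is adjacent to
both ends of this edge. -/
def withEdgeNodes {V : Type*} (G : SimpleGraph V) : SimpleGraph (V ⊕ G.Dart) where
  Adj
    | .inl a, .inl b => G.Adj a b
    | .inl a, .inr e => a = e.fst ∨ a = e.snd
    | .inr e, .inl a => a = e.fst ∨ a = e.snd
    | .inr _, .inr _ => False
  symm := ⟨by
    rintro (a | e) (b | f) h
    · exact SimpleGraph.Adj.symm (G := G) h
    · exact h
    · exact h
    · exact h⟩
  loopless := ⟨by
    rintro (a | e) h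
    · exact G.loopless.irrefl a h
    · exact h⟩

section EdgeNodes

variable {V : Type*} {G : SimpleGraph V}

theorem withEdgeNodes_adj_inl_inl {a b : V} :
    (withEdgeNodes G).Adj (.inl a) (.inl b) ↔ G.Adj a b := Iff.rfl

theorem withEdgeNodes_adj_inl_inr {a : V} {e : G.Dart} :
    (withEdgeNodes G).Adj (.inl a) (.inr e) ↔ a = e.fst ∨ a = e.snd := Iff.rfl

theorem withEdgeNodes_adj_inr_inl {a : V} {e : G.Dart} :
    (withEdgeNodes G).Adj (.inr e) (.inl a) ↔ a = e.fst ∨ a = e.snd := Iff.rfl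

theorem within_withEdgeNodes_aux {n : ℕ} {u : V} {x : V ⊕ G.Dart}
    (h : Within (withEdgeNodes G) n (.inl u) x) :
    (∀ a, x = .inl a → Within G n u a) ∧
      ∀ e, x = .inr e → ∃ m, m + 1 = n ∧ (Within G m u e.fst ∨ Within G m u e.snd) := by
  induction n generalizing x with
  | zero =>
    rw [within_zero_iff] at h
    subst h
    exact ⟨fun a ha => within_zero_iff.2 (Sum.inl_injective ha), fun e he => by simp at he⟩
  | succ n ih =>
    rcases within_succ_iff.1 h with h | ⟨y, h, hadj⟩
    · refine ⟨fun a ha => ((ih h).1 a ha).mono n.le_succ, fun e he => ⟨n, rfl, ?_⟩⟩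
      obtain ⟨m, rfl, hm⟩ := (ih h).2 e he
      exact hm.imp (fun h => h.mono (by omega)) fun h => h.mono (by omega)
    · refine ⟨?_, ?_⟩
      · rintro a rfl
        rcases y with b | e
        · exact ((ih h).1 b rfl).trans (Within.of_adj hadj)
        · obtain ⟨m, rfl, hm⟩ := (ih h).2 e rfl
          have he : Within G 1 e.fst e.snd := Within.of_adj e.adj
          rcases withEdgeNodes_adj_inr_inl.1 hadj with rfl | rfl
          · rcases hm with hm | hm
            · exact hm.mono (by omega)
            · exact (hm.trans he.symm).mono (by omega)
          · rcases hm with hm | hm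
            · exact (hm.trans he).mono (by omega)
            · exact hm.mono (by omega)
      · rintro e rfl
        rcases y with b | f
        · refine ⟨n, rfl, ?_⟩
          have hb := (ih h).1 b rfl
          rcases withEdgeNodes_adj_inl_inr.1 hadj with rfl | rfl
          · exact Or.inl hb
          · exact Or.inr hb
        · exact hadj.elim

theorem within_withEdgeNodes_inl {n : ℕ} {u a : V} :
    Within (withEdgeNodes G) n (.inl u) (.inl a) ↔ Within G n u a := by
  refine ⟨fun h => (within_withEdgeNodes_aux h).1 a rfl, fun h => ?_⟩
  induction n generalizing a with
  | zero => rw [within_zero_iff] at *; rw [h]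
  | succ n ih =>
    rcases within_succ_iff.1 h with h | ⟨v, h, hadj⟩
    · exact (ih h).mono n.le_succ
    · exact (ih h).trans (Within.of_adj (withEdgeNodes_adj_inl_inl.2 hadj))

theorem within_withEdgeNodes_inr {n : ℕ} {u : V} {e : G.Dart} :
    Within (withEdgeNodes G) n (.inl u) (.inr e) ↔
      ∃ m, m + 1 = n ∧ (Within G m u e.fst ∨ Within G m u e.snd) := by
  refine ⟨fun h => (within_withEdgeNodes_aux h).2 e rfl, ?_⟩
  rintro ⟨m, rfl, h | h⟩
  · exact (within_withEdgeNodes_inl.2 h).trans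
      (Within.of_adj (withEdgeNodes_adj_inl_inr.2 (Or.inl rfl)))
  · exact (within_withEdgeNodes_inl.2 h).trans
      (Within.of_adj (withEdgeNodes_adj_inl_inr.2 (Or.inr rfl)))

theorem edist_eq_of_within_iff {V' : Type*} {H : SimpleGraph V'} {a b : V} {c d : V'}
    (h : ∀ n, Within G n a b ↔ Within H n c d) : G.edist a b = H.edist c d := by
  refine le_antisymm ?_ ?_
  · rcases eq_or_ne (H.edist c d) ⊤ with htop | htop
    · rw [htop]; exact le_top
    · obtain ⟨n, hn⟩ := ENat.ne_top_iff_exists.1 htop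
      rw [← hn]
      exact (h n).2 hn.ge
  · rcases eq_or_ne (G.edist a b) ⊤ with htop | htop
    · rw [htop]; exact le_top
    · obtain ⟨n, hn⟩ := ENat.ne_top_iff_exists.1 htop
      rw [← hn]
      exact (h n).1 hn.ge

theorem edist_withEdgeNodes_inl (u a : V) :
    (withEdgeNodes G).edist (.inl u) (.inl a) = G.edist u a :=
  edist_eq_of_within_iff fun _ => within_withEdgeNodes_inl

theorem Within.both_of_dart {n k : ℕ} {u : V} {e : G.Dart} (hn : n + 1 ≤ k)
    (h : Within G n u e.fst ∨ Within G n u e.snd) :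
    Within G k u e.fst ∧ Within G k u e.snd ∧ ¬ (G.edist u e.fst = k ∧ G.edist u e.snd = k) := by
  have he : Within G 1 e.fst e.snd := Within.of_adj e.adj
  rcases h with h | h
  · exact ⟨h.mono (by omega), (h.trans he).mono hn,
      fun hk => (edist_eq_coe_iff.1 hk.1).2 n (by omega) h⟩
  · exact ⟨(h.trans he.symm).mono hn, h.mono (by omega),
      fun hk => (edist_eq_coe_iff.1 hk.2).2 n (by omega) h⟩

/-- Equal views in `G` remain equal when nodes are attached to the edges. -/
theorem IsViewIso.withEdgeNodes {k : ℕ} {u v : V} {φ : V → V} (hφ : IsViewIso G k u v φ) :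
    ∃ ψ, IsViewIso (withEdgeNodes G) k (.inl u) (.inl v) ψ := by
  classical
  set ψ : V ⊕ G.Dart → V ⊕ G.Dart := fun x => match x with
    | .inl a => .inl (φ a)
    | .inr e => if h : G.Adj (φ e.fst) (φ e.snd) then .inr ⟨(φ e.fst, φ e.snd), h⟩ else .inr e
    with hψ
  have hinl : ∀ a, ψ (.inl a) = .inl (φ a) := fun a => rfl
  have hview : ∀ e : G.Dart, Within (_root_.withEdgeNodes G) k (.inl u) (.inr e) →
      Within G k u e.fst ∧ Within G k u e.snd ∧ ¬ (G.edist u e.fst = k ∧ G.edist u e.snd = k) := by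
    intro e he
    obtain ⟨m, hm, h⟩ := within_withEdgeNodes_inr.1 he
    exact Within.both_of_dart hm.le h
  have hinr : ∀ e : G.Dart, Within (_root_.withEdgeNodes G) k (.inl u) (.inr e) →
      ∃ h : G.Adj (φ e.fst) (φ e.snd), ψ (.inr e) = .inr ⟨(φ e.fst, φ e.snd), h⟩ := by
    intro e he
    obtain ⟨h1, h2, h3⟩ := hview e he
    have h : G.Adj (φ e.fst) (φ e.snd) := (hφ.adj_iff _ _ h1 h2 h3).2 e.adj
    exact ⟨h, dif_pos h⟩
  have hwithin : ∀ {n a}, Within G k u a → (Within G n v (φ a) ↔ Within G n u a) := by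
    intro n a ha
    rw [Within, Within, hφ.edist_eq a ha]
  refine ⟨ψ, ⟨?_, ?_, ?_, ?_, ?_⟩⟩
  · rw [hinl, hφ.map_root]
  · rintro (a | e) hx
    · rw [hinl, edist_withEdgeNodes_inl, edist_withEdgeNodes_inl,
        hφ.edist_eq a (within_withEdgeNodes_inl.1 hx)]
    · obtain ⟨h1, h2, -⟩ := hview e hx
      obtain ⟨h, he⟩ := hinr e hx
      refine edist_eq_of_within_iff fun n => ?_
      rw [he, within_withEdgeNodes_inr, within_withEdgeNodes_inr]
      simp only [hwithin h1, hwithin h2]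
  · rintro (a | e) hx (b | f) hy hxy
    · rw [hinl, hinl] at hxy
      rw [hφ.injOn (within_withEdgeNodes_inl.1 hx) (within_withEdgeNodes_inl.1 hy)
        (Sum.inl_injective hxy)]
    · obtain ⟨h, he⟩ := hinr f hy
      rw [hinl, he] at hxy
      simp at hxy
    · obtain ⟨h, he⟩ := hinr e hx
      rw [hinl, he] at hxy
      simp at hxy
    · obtain ⟨h, he⟩ := hinr e hx
      obtain ⟨h', hf⟩ := hinr f hy
      obtain ⟨h1, h2, -⟩ := hview e hx
      obtain ⟨h1', h2', -⟩ := hview f hy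
      rw [he, hf] at hxy
      simp only [Sum.inr.injEq, SimpleGraph.Dart.mk.injEq, Prod.mk.injEq] at hxy
      refine congrArg Sum.inr (SimpleGraph.Dart.ext _ _ (Prod.ext ?_ ?_))
      · exact hφ.injOn h1 h1' hxy.1
      · exact hφ.injOn h2 h2' hxy.2
  · rintro (a | e) hx
    · obtain ⟨z, hz, hza⟩ := hφ.surj a (within_withEdgeNodes_inl.1 hx)
      exact ⟨.inl z, within_withEdgeNodes_inl.2 hz, by rw [hinl, hza]⟩
    · obtain ⟨m, hm, hme⟩ := within_withEdgeNodes_inr.1 hx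
      obtain ⟨h1, h2, h3⟩ := Within.both_of_dart hm.le hme
      obtain ⟨a, ha, hae⟩ := hφ.surj _ h1
      obtain ⟨b, hb, hbe⟩ := hφ.surj _ h2
      have hadj : G.Adj a b := by
        rw [← hφ.adj_iff a b ha hb, hae, hbe]
        · exact e.adj
        · rw [← hφ.edist_eq a ha, ← hφ.edist_eq b hb, hae, hbe]
          exact h3
      have hw : Within (_root_.withEdgeNodes G) k (.inl u) (.inr ⟨(a, b), hadj⟩) := by
        refine within_withEdgeNodes_inr.2 ⟨m, hm, ?_⟩
        rw [← hwithin ha, ← hwithin hb, hae, hbe]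
        exact hme
      obtain ⟨h, he⟩ := hinr _ hw
      refine ⟨_, hw, he.trans (congrArg Sum.inr (SimpleGraph.Dart.ext _ _ (Prod.ext hae hbe)))⟩
  · rintro (a | e) (b | f) hx hy hne
    · rw [hinl, hinl, withEdgeNodes_adj_inl_inl, withEdgeNodes_adj_inl_inl]
      rw [edist_withEdgeNodes_inl, edist_withEdgeNodes_inl] at hne
      exact hφ.adj_iff a b (within_withEdgeNodes_inl.1 hx) (within_withEdgeNodes_inl.1 hy) hne
    · obtain ⟨h, he⟩ := hinr f hy
      obtain ⟨h1, h2, -⟩ := hview f hy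
      rw [hinl, he, withEdgeNodes_adj_inl_inr, withEdgeNodes_adj_inl_inr,
        ← hφ.injOn.eq_iff (within_withEdgeNodes_inl.1 hx) h1,
        ← hφ.injOn.eq_iff (within_withEdgeNodes_inl.1 hx) h2]
    · obtain ⟨h, he⟩ := hinr e hx
      obtain ⟨h1, h2, -⟩ := hview e hx
      rw [hinl, he, withEdgeNodes_adj_inr_inl, withEdgeNodes_adj_inr_inl,
        ← hφ.injOn.eq_iff (within_withEdgeNodes_inl.1 hy) h1,
        ← hφ.injOn.eq_iff (within_withEdgeNodes_inl.1 hy) h2]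
    · obtain ⟨h, he⟩ := hinr e hx
      obtain ⟨h', hf⟩ := hinr f hy
      rw [he, hf]
      exact Iff.rfl

end EdgeNodes

/-! ### Expected outputs of nodes with equal views -/

section Averaging

variable {V : Type*} {G : SimpleGraph V} {k : ℕ} {u v : V}

theorem IsViewIso.localView_eq {L : Type*} {φ : V → V} (hφ : IsViewIso G k u v φ) (label : V → L) :
    localView G k (fun z => label (φ z)) u = localView G k label v := by
  have hmem : ∀ {z}, Within G k u z → Within G k v (φ z) := fun {z} hz => by
    rw [Within, hφ.edist_eq z hz]
    exact hz
  rw [localView, localView, hφ.map_root]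
  congr 1
  · ext l
    constructor
    · rintro ⟨z, hz, rfl⟩
      exact ⟨φ z, hmem hz, rfl⟩
    · rintro ⟨y, hy, rfl⟩
      obtain ⟨z, hz, rfl⟩ := hφ.surj y hy
      exact ⟨z, hz, rfl⟩
  · ext a b
    constructor
    · rintro ⟨x, y, hx, hy, hadj, hne, rfl, rfl⟩
      refine ⟨φ x, φ y, hmem hx, hmem hy, (hφ.adj_iff x y hx hy hne).2 hadj, ?_, rfl, rfl⟩
      rwa [hφ.edist_eq x hx, hφ.edist_eq y hy]
    · rintro ⟨x, y, hx, hy, hadj, hne, rfl, rfl⟩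
      obtain ⟨x, hx', rfl⟩ := hφ.surj x hx
      obtain ⟨y, hy', rfl⟩ := hφ.surj y hy
      rw [hφ.edist_eq x hx', hφ.edist_eq y hy'] at hne
      exact ⟨x, y, hx', hy', (hφ.adj_iff x y hx' hy' hne).1 hadj, hne, rfl, rfl⟩

theorem IsViewIso.congr {φ ψ : V → V} (hφ : IsViewIso G k u v φ)
    (h : ∀ z, Within G k u z → ψ z = φ z) : IsViewIso G k u v ψ where
  map_root := (h u (Within.refl _ _)).trans hφ.map_root
  edist_eq z hz := by rw [h z hz, hφ.edist_eq z hz]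
  injOn := hφ.injOn.congr fun z hz => (h z hz).symm
  surj y hy := by
    obtain ⟨z, hz, hzy⟩ := hφ.surj y hy
    exact ⟨z, hz, (h z hz).trans hzy⟩
  adj_iff a b ha hb hne := by rw [h a ha, h b hb, hφ.adj_iff a b ha hb hne]

theorem IsViewIso.exists_perm [Finite V] {φ : V → V} (hφ : IsViewIso G k u v φ) :
    ∃ ψ : Equiv.Perm V, IsViewIso G k u v ψ := by
  classical
  have := Fintype.ofFinite V
  have hbij : Set.BijOn φ {z | Within G k u z} {y | Within G k v y} := by
    refine ⟨fun z hz => ?_, hφ.injOn, fun y hy => hφ.surj y hy⟩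
    show G.edist v (φ z) ≤ k
    rw [hφ.edist_eq z hz]
    exact hz
  let e : {z // Within G k u z} ≃ {y // Within G k v y} := hbij.equiv φ
  exact ⟨e.extendSubtype, hφ.congr fun z hz => e.extendSubtype_apply_of_mem z hz⟩

variable [Fintype V] {I Ω : Type*} [MeasurableSpace Ω]

/-- Permuting the nodes does not change the distribution of independent seeds. -/
theorem lintegral_comp_perm (μ : Measure Ω) [IsProbabilityMeasure μ] (ψ : Equiv.Perm V)
    (F : (V → Ω) → ℝ≥0∞) :
    ∫⁻ ω, F (fun z => ω (ψ z)) ∂(Measure.pi fun _ : V => μ) =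
      ∫⁻ ω, F ω ∂(Measure.pi fun _ : V => μ) := by
  have h := measurePreserving_piCongrLeft (α := fun _ : V => Ω) (fun _ => μ) ψ.symm
  rw [h.lintegral_map_equiv F]
  refine lintegral_congr fun ω => ?_
  congr 1
  funext z
  have := Equiv.piCongrLeft_apply_apply (fun _ : V => Ω) ψ.symm ω (ψ z)
  rw [Equiv.symm_apply_apply] at this
  exact this.symm

/-- The expected output of a node, up to the factor `(card V)!`, if the identifiers are those of
`id` in random order. -/
noncomputable def averageOutput (A : LocalAlgorithm I Ω ℝ≥0) (G : SimpleGraph V) (k : ℕ)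
    (μ : Measure Ω) [IsProbabilityMeasure μ] (id : V ↪ I) (u : V) : ℝ≥0∞ := by
  classical exact ∑ π : Equiv.Perm V,
    ∫⁻ ω, (A.run G k (π.toEmbedding.trans id) ω u : ℝ≥0∞) ∂(Measure.pi fun _ : V => μ)

theorem IsViewIso.averageOutput_eq {φ : V → V} (hφ : IsViewIso G k u v φ)
    (A : LocalAlgorithm I Ω ℝ≥0) (μ : Measure Ω) [IsProbabilityMeasure μ] (id : V ↪ I) :
    averageOutput A G k μ id v = averageOutput A G k μ id u := by
  classical
  obtain ⟨ψ, hψ⟩ := hφ.exists_perm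
  symm
  rw [averageOutput, averageOutput, ← Equiv.sum_comp (Equiv.mulRight ψ)]
  refine Finset.sum_congr rfl fun π _ => ?_
  rw [← lintegral_comp_perm μ ψ]
  refine lintegral_congr fun ω => ?_
  congr 1
  exact congrArg A (hψ.localView_eq fun z => ((π.toEmbedding.trans id) z, ω z))

/-- Let each `u ∈ U` have the same view as `v u`, and let `w u` be a node whose only neighbours are
`u` and `v u`. In expectation, `u` and `v u` have the same output, so that the nodes `u` and `w u`
contribute at least `1 / 2`. -/
theorem card_le_two_mul_iSup_lintegral {A : LocalAlgorithm I Ω ℝ≥0} {μ : Measure Ω}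
    [IsProbabilityMeasure μ] (hA : SolvesFractionalDominatingSet A G k μ)
    (hI : Nonempty (V ↪ I)) (U : Finset V) (v w : V → V) (hw : Set.InjOn w U)
    (hdisj : ∀ u ∈ U, ∀ u' ∈ U, w u' ≠ u)
    (hnbr : ∀ u ∈ U, ∀ y, G.Adj (w u) y → y = u ∨ y = v u)
    (hview : ∀ u ∈ U, ∃ φ, IsViewIso G k u (v u) φ) :
    (U.card : ℝ≥0∞) ≤ 2 * ⨆ id : V ↪ I,
      ∫⁻ ω, ((∑ z, A.run G k id ω z : ℝ≥0) : ℝ≥0∞) ∂(Measure.pi fun _ : V => μ) := by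
  classical
  obtain ⟨id₀⟩ := hI
  set X : ℝ≥0∞ := ⨆ id : V ↪ I,
    ∫⁻ ω, ((∑ z, A.run G k id ω z : ℝ≥0) : ℝ≥0∞) ∂(Measure.pi fun _ : V => μ) with hX
  set S := averageOutput A G k μ id₀ with hS
  set N : ℝ≥0∞ := (Fintype.card (Equiv.Perm V) : ℝ≥0∞) with hN
  have hmeas : ∀ id z, Measurable fun ω : V → Ω => (A.run G k id ω z : ℝ≥0∞) :=
    fun id z => ((hA id).1 z).coe_nnreal_ennreal
  have hone : ∀ u ∈ U, ∀ id : V ↪ I, 1 ≤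
      ∫⁻ ω, (A.run G k id ω (w u) : ℝ≥0∞) ∂(Measure.pi fun _ : V => μ) +
      (∫⁻ ω, (A.run G k id ω u : ℝ≥0∞) ∂(Measure.pi fun _ : V => μ) +
      ∫⁻ ω, (A.run G k id ω (v u) : ℝ≥0∞) ∂(Measure.pi fun _ : V => μ)) := by
    intro u hu id
    rw [← lintegral_add_left (hmeas id u), ← lintegral_add_left (hmeas id (w u))]
    calc (1 : ℝ≥0∞) = ∫⁻ _, 1 ∂(Measure.pi fun _ : V => μ) := by simp
      _ ≤ _ := by
        refine lintegral_mono_ae ?_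
        filter_upwards [(hA id).2] with ω hω
        have h1 := hω (w u)
        have h2 : ∑ y with y = w u ∨ G.Adj (w u) y, A.run G k id ω y ≤
            ∑ y ∈ {w u, u, v u}, A.run G k id ω y := by
          refine Finset.sum_le_sum_of_subset fun y hy => ?_
          simp only [Finset.mem_filter, Finset.mem_univ, true_and] at hy
          simp only [Finset.mem_insert, Finset.mem_singleton]
          exact hy.imp_right (hnbr u hu y)
        have h3 : ∑ y ∈ {w u, u, v u}, A.run G k id ω y ≤
            A.run G k id ω (w u) + (A.run G k id ω u + A.run G k id ω (v u)) := by
          have hins : ∀ (a : V) (s : Finset V), ∑ y ∈ insert a s, A.run G k id ω y ≤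
              A.run G k id ω a + ∑ y ∈ s, A.run G k id ω y := by
            intro a s
            by_cases ha : a ∈ s
            · rw [Finset.insert_eq_of_mem ha]
              exact le_add_self
            · rw [Finset.sum_insert ha]
          refine (hins _ _).trans (add_le_add_right ((hins _ _).trans ?_) _)
          rw [Finset.sum_singleton]
        exact_mod_cast h1.trans (h2.trans h3)
  have hsum : ∀ u ∈ U, N ≤ S (w u) + (S u + S u) := by
    intro u hu
    obtain ⟨φ, hφ⟩ := hview u hu
    have : S u + S u = S u + S (v u) := by rw [hS, hφ.averageOutput_eq]
    rw [this, hS, averageOutput, averageOutput, averageOutput, ← Finset.sum_add_distrib,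
      ← Finset.sum_add_distrib]
    calc N = ∑ _π : Equiv.Perm V, (1 : ℝ≥0∞) := by simp [hN]
      _ ≤ _ := Finset.sum_le_sum fun π _ => hone u hu _
  have htotal : ∑ z, S z ≤ N * X := by
    calc ∑ z, S z = ∑ π : Equiv.Perm V, ∫⁻ ω,
          ((∑ z, A.run G k (π.toEmbedding.trans id₀) ω z : ℝ≥0) : ℝ≥0∞)
            ∂(Measure.pi fun _ : V => μ) := by
          simp only [hS, averageOutput]
          rw [Finset.sum_comm]
          refine Finset.sum_congr rfl fun π _ => ?_
          rw [← lintegral_finsetSum _ fun z _ => hmeas _ z]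
          simp only [ENNReal.ofNNReal_finsetSum]
      _ ≤ ∑ _π : Equiv.Perm V, X := Finset.sum_le_sum fun π _ =>
          le_iSup (fun id : V ↪ I => ∫⁻ ω, ((∑ z, A.run G k id ω z : ℝ≥0) : ℝ≥0∞)
            ∂(Measure.pi fun _ : V => μ)) (π.toEmbedding.trans id₀)
      _ = N * X := by simp [hN]
  have hU : ∑ u ∈ U, (S (w u) + S u) ≤ ∑ z, S z := by
    rw [Finset.sum_add_distrib, ← Finset.sum_image hw, ← Finset.sum_union]
    · exact Finset.sum_le_sum_of_subset (Finset.subset_univ _)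
    · rw [Finset.disjoint_left]
      intro z hz hzU
      obtain ⟨u', hu', rfl⟩ := Finset.mem_image.1 hz
      exact hdisj _ hzU u' hu' rfl
  have hfinal : N * U.card ≤ N * (2 * X) := by
    calc N * U.card = ∑ u ∈ U, N := by simp [mul_comm]
      _ ≤ ∑ u ∈ U, 2 * (S (w u) + S u) := by
          refine Finset.sum_le_sum fun u hu => (hsum u hu).trans ?_
          rw [mul_add, two_mul (S u)]
          gcongr
          rw [two_mul]
          exact le_self_add
      _ = 2 * ∑ u ∈ U, (S (w u) + S u) := by rw [Finset.mul_sum]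
      _ ≤ 2 * (N * X) := by gcongr; exact hU.trans htotal
      _ = N * (2 * X) := by ring
  have hN0 : N ≠ 0 := by simp [hN]
  have hNt : N ≠ ⊤ := ENNReal.natCast_ne_top _
  exact (ENNReal.mul_le_mul_iff_right hN0 hNt).1 hfinal

end Averaging

/-! ### From expected outputs to approximation ratios -/

section Ratio

variable {V I Ω : Type*} {G : SimpleGraph V} {k : ℕ}

theorem dominationNumber_le_ncard {S : Set V} (hS : IsDominatingSet G S) :
    dominationNumber G ≤ S.ncard :=
  Nat.sInf_le ⟨S, hS, rfl⟩

/-- A dominating set algorithm as a fractional dominating set algorithm with outputs `0` and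
`1`. -/
noncomputable def LocalAlgorithm.toFractional (A : LocalAlgorithm I Ω Bool) :
    LocalAlgorithm I Ω ℝ≥0 :=
  fun x => if A x = true then 1 else 0

theorem LocalAlgorithm.run_toFractional (A : LocalAlgorithm I Ω Bool) (id : V ↪ I) (ω : V → Ω)
    (v : V) : A.toFractional.run G k id ω v = if A.run G k id ω v = true then 1 else 0 := rfl

variable [Fintype V]

theorem fractionalDominationNumber_le_ncard {S : Set V} (hS : IsDominatingSet G S) :
    fractionalDominationNumber G ≤ S.ncard := by
  classical
  refine csInf_le (OrderBot.bddBelow _) ⟨fun v => if v ∈ S then 1 else 0, fun v => ?_, ?_⟩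
  · obtain ⟨u, hu, huS⟩ : ∃ u, (u = v ∨ G.Adj v u) ∧ u ∈ S := by
      rcases hS v with h | ⟨u, h, hadj⟩
      · exact ⟨v, Or.inl rfl, h⟩
      · exact ⟨u, Or.inr hadj, h⟩
    refine le_trans (by simp [huS]) (Finset.single_le_sum
      (f := fun v => if v ∈ S then (1 : ℝ≥0) else 0)
      (fun _ _ => zero_le) (Finset.mem_filter.2 ⟨Finset.mem_univ u, hu⟩))
  · rw [Finset.sum_boole, Set.ncard_eq_toFinset_card' S]
    congr 2
    ext; simp

theorem sum_run_toFractional (A : LocalAlgorithm I Ω Bool) (id : V ↪ I) (ω : V → Ω) :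
    ((∑ v, A.toFractional.run G k id ω v : ℝ≥0) : ℝ≥0∞) =
      (Set.ncard {v | A.run G k id ω v = true} : ℝ≥0∞) := by
  classical
  simp only [LocalAlgorithm.run_toFractional]
  rw [Finset.sum_boole, Set.ncard_eq_toFinset_card']
  simp

variable [MeasurableSpace Ω]

theorem SolvesDominatingSet.toFractional {A : LocalAlgorithm I Ω Bool} {μ : Measure Ω}
    [IsProbabilityMeasure μ] (hA : SolvesDominatingSet A G k μ) :
    SolvesFractionalDominatingSet A.toFractional G k μ := by
  classical
  intro id
  refine ⟨fun v => ?_, ?_⟩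
  · simp only [LocalAlgorithm.run_toFractional]
    exact (Measurable.of_discrete (f := fun b : Bool => if b = true then (1 : ℝ≥0) else 0)).comp
      ((hA id).1 v)
  · filter_upwards [(hA id).2] with ω hω v
    obtain ⟨u, hu, huS⟩ : ∃ u, (u = v ∨ G.Adj v u) ∧ A.run G k id ω u = true := by
      rcases hω v with h | ⟨u, h, hadj⟩
      · exact ⟨v, Or.inl rfl, h⟩
      · exact ⟨u, Or.inr hadj, h⟩
    refine le_trans (by rw [LocalAlgorithm.run_toFractional, if_pos huS]) (Finset.single_le_sum
      (f := fun u => A.toFractional.run G k id ω u)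
      (fun _ _ => zero_le) (Finset.mem_filter.2 ⟨Finset.mem_univ u, hu⟩))

theorem le_fractionalDominatingSetRatio {A : LocalAlgorithm I Ω ℝ≥0} {μ : Measure Ω}
    [IsProbabilityMeasure μ] (hA : SolvesFractionalDominatingSet A G k μ)
    (hI : Nonempty (V ↪ I)) (U : Finset V) (v w : V → V) (hw : Set.InjOn w U)
    (hdisj : ∀ u ∈ U, ∀ u' ∈ U, w u' ≠ u)
    (hnbr : ∀ u ∈ U, ∀ y, G.Adj (w u) y → y = u ∨ y = v u)
    (hview : ∀ u ∈ U, ∃ φ, IsViewIso G k u (v u) φ) {S : Set V} (hS : IsDominatingSet G S) :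
    (U.card : ℝ≥0∞) / 2 / S.ncard ≤ fractionalDominatingSetRatio A G k μ := by
  rw [fractionalDominatingSetRatio, ← ENNReal.iSup_div]
  refine ENNReal.div_le_div ?_ ?_
  · refine ENNReal.div_le_of_le_mul ?_
    rw [mul_comm]
    exact card_le_two_mul_iSup_lintegral hA hI U v w hw hdisj hnbr hview
  · exact_mod_cast fractionalDominationNumber_le_ncard hS

theorem le_dominatingSetRatio {A : LocalAlgorithm I Ω Bool} {μ : Measure Ω}
    [IsProbabilityMeasure μ] (hA : SolvesDominatingSet A G k μ)
    (hI : Nonempty (V ↪ I)) (U : Finset V) (v w : V → V) (hw : Set.InjOn w U)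
    (hdisj : ∀ u ∈ U, ∀ u' ∈ U, w u' ≠ u)
    (hnbr : ∀ u ∈ U, ∀ y, G.Adj (w u) y → y = u ∨ y = v u)
    (hview : ∀ u ∈ U, ∃ φ, IsViewIso G k u (v u) φ) {S : Set V} (hS : IsDominatingSet G S) :
    (U.card : ℝ≥0∞) / 2 / S.ncard ≤ dominatingSetRatio A G k μ := by
  rw [dominatingSetRatio, ← ENNReal.iSup_div]
  simp only [← sum_run_toFractional]
  refine ENNReal.div_le_div ?_ ?_
  · refine ENNReal.div_le_of_le_mul ?_
    rw [mul_comm]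
    exact card_le_two_mul_iSup_lintegral hA.toFractional hI U v w hw hdisj hnbr hview
  · exact_mod_cast dominationNumber_le_ncard hS

end Ratio

/-! ### Cluster graphs of high girth -/

section ClusterGraph

open Finset

/-- The clusters of the cluster tree of order `k`. -/
abbrev ClusterWord (k : ℕ) : Type := {w : List ℕ // IsClusterWord k w}

noncomputable instance (k : ℕ) : Fintype (ClusterWord k) := (finite_isClusterWord k).fintype

/-- The nodes of the cluster graph: the size of the clusters decreases by the factor `δ` from a
cluster to its children. -/
abbrev ClusterNode (k δ m : ℕ) : Type := Σ w : ClusterWord k, Fin (δ ^ (m - w.1.length))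

/-- One of the two clusters is the parent of the other one. -/
def IsLink (c d : List ℕ) : Prop := (∃ i, d = i :: c) ∨ ∃ i, c = i :: d

open scoped Classical in
/-- The number of neighbours in the cluster `d` of a node of the cluster `c`. -/
noncomputable def clusterDegree {k : ℕ} (δ : ℕ) (c d : ClusterWord k) : ℕ :=
  if IsLink c.1 d.1 then δ ^ linkLabel c.1 d.1 else 0

variable {k δ m : ℕ}

theorem IsLink.symm {c d : List ℕ} (h : IsLink c d) : IsLink d c := Or.symm h

theorem isLink_linkEnd (w : List ℕ) (i : ℕ) : IsLink w (linkEnd w i) := by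
  by_cases h : upLabel w = some i
  · obtain ⟨j, w', rfl, rfl⟩ := upLabel_eq_some h
    rw [linkEnd_cons_succ]
    exact Or.inr ⟨j, rfl⟩
  · rw [linkEnd_of_ne h]
    exact Or.inl ⟨i, rfl⟩

theorem IsClusterWord.linkEnd {w : List ℕ} (hw : IsClusterWord k w) {i : ℕ}
    (hi : HasLabel k w i) : IsClusterWord k (linkEnd w i) := by
  by_cases h : upLabel w = some i
  · obtain ⟨j, w', rfl, rfl⟩ := upLabel_eq_some h
    rw [linkEnd_cons_succ]
    exact hw.1
  · rw [linkEnd_of_ne h]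
    obtain ⟨h1, h2⟩ := hi.resolve_left h
    exact ⟨hw, h1, h2, h⟩

theorem IsLink.hasLabel {c d : List ℕ} (hd : IsClusterWord k d) (h : IsLink c d) :
    HasLabel k c (linkLabel c d) := by
  rcases h with ⟨i, rfl⟩ | ⟨i, rfl⟩
  · rw [linkLabel_cons_right]
    exact Or.inr ⟨hd.2.1, hd.2.2.1⟩
  · rw [linkLabel_cons_left]
    exact Or.inl rfl

theorem IsLink.linkEnd_eq {c d : List ℕ} (hd : IsClusterWord k d) (h : IsLink c d) :
    linkEnd c (linkLabel c d) = d := by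
  rcases h with ⟨i, rfl⟩ | ⟨i, rfl⟩
  · rw [linkLabel_cons_right, linkEnd_of_ne hd.2.2.2]
  · rw [linkLabel_cons_left, linkEnd_cons_succ]

theorem IsLink.linkLabel_le {c d : List ℕ} (hc : IsClusterWord k c) (hd : IsClusterWord k d)
    (h : IsLink c d) : linkLabel c d ≤ k + 1 := by
  rcases h.hasLabel hd with h | h
  · exact (upLabel_le_wordLevel h).trans hc.wordLevel_le
  · omega

theorem clusterDegree_le (hδ : 1 ≤ δ) (c d : ClusterWord k) :
    clusterDegree δ c d ≤ δ ^ (k + 1) := by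
  rw [clusterDegree]
  split_ifs with h
  · exact Nat.pow_le_pow_right hδ (h.linkLabel_le c.2 d.2)
  · exact Nat.zero_le _

theorem isLink_of_clusterDegree_pos {c d : ClusterWord k} (h : 0 < clusterDegree δ c d) :
    IsLink c.1 d.1 := by
  by_contra hn
  simp [clusterDegree, hn] at h

theorem clusterDegree_self (c : ClusterWord k) : clusterDegree δ c c = 0 := by
  refine if_neg ?_
  rintro (⟨i, h⟩ | ⟨i, h⟩) <;> simpa using congrArg List.length h

theorem clusterDegree_of_isLink {c d : ClusterWord k} (h : IsLink c.1 d.1) :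
    clusterDegree δ c d = δ ^ linkLabel c.1 d.1 := if_pos h

open scoped Classical in
theorem card_cluster (c : ClusterWord k) :
    #{u : ClusterNode k δ m | u.1 = c} = δ ^ (m - c.1.length) := by
  rw [← Fintype.card_subtype, Fintype.card_congr (Equiv.sigmaSubtype c), Fintype.card_fin]

open scoped Classical in
theorem card_mul_clusterDegree_comm (hm : k + 1 ≤ m) (c d : ClusterWord k) :
    #{u : ClusterNode k δ m | u.1 = c} * clusterDegree δ c d =
      #{v : ClusterNode k δ m | v.1 = d} * clusterDegree δ d c := by
  have key : ∀ {c d : ClusterWord k} (i : ℕ), d.1 = i :: c.1 →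
      #{u : ClusterNode k δ m | u.1 = c} * clusterDegree δ c d =
        #{v : ClusterNode k δ m | v.1 = d} * clusterDegree δ d c := by
    intro c d i h
    have hlen := (length_le_wordLevel d.1).trans d.2.wordLevel_le
    rw [card_cluster, card_cluster, clusterDegree_of_isLink (Or.inl ⟨i, h⟩),
      clusterDegree_of_isLink (Or.inr ⟨i, h⟩), ← pow_add, ← pow_add]
    rw [h] at hlen ⊢
    rw [linkLabel_cons_left, linkLabel_cons_right]
    simp only [List.length_cons] at hlen ⊢
    congr 1
    omega
  by_cases h : IsLink c.1 d.1
  · rcases h with ⟨i, h⟩ | ⟨i, h⟩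
    · exact key i h
    · exact (key i h).symm
  · rw [clusterDegree, clusterDegree, if_neg h, if_neg fun h' => h h'.symm, mul_zero, mul_zero]

theorem ncard_neighbors_le (hδ : 1 ≤ δ) {G : SimpleGraph (ClusterNode k δ m)}
    (hG : DegreesAtMost G (fun v => v.1) (clusterDegree δ)) (v : ClusterNode k δ m) :
    {w | G.Adj v w}.ncard ≤ Fintype.card (ClusterWord k) * δ ^ (k + 1) := by
  classical
  have h : {w | G.Adj v w} = ((univ.filter fun w => G.Adj v w : Finset _) : Set _) := by
    ext; simp
  rw [h, Set.ncard_coe_finset, mul_comm]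
  refine (card_le_mul_card_image (f := fun w => w.1) _ (δ ^ (k + 1)) fun d _ => ?_).trans
    (Nat.mul_le_mul_left _ (card_le_univ _))
  refine le_trans (card_le_card fun w hw => ?_) ((hG v d).trans (clusterDegree_le hδ _ _))
  simp only [mem_filter, mem_univ, true_and] at hw
  exact mem_nbrsIn.2 hw

/-- The size `δ ^ rootExponent k` of the root cluster: large enough for the clusters to exceed balls
of radius `2 * k - 1`, and small enough for the bound on the number of nodes. For `k = 1`, these
balls need only be bounded by the numbers of neighbours. -/
def rootExponent (k : ℕ) : ℕ := if k = 1 then 3 else 2 * k ^ 2 + 2 * k + 1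

theorem rootExponent_add_le (hk : 1 ≤ k) : rootExponent k + k ≤ 4 * k ^ 2 := by
  rw [rootExponent]
  split_ifs with h
  · subst h; norm_num
  · have : 2 ≤ k := by omega
    nlinarith

theorem succ_le_rootExponent (k : ℕ) : k + 1 ≤ rootExponent k := by
  rw [rootExponent]
  split_ifs with h
  · omega
  · nlinarith

open scoped Classical in
/-- Balls of radius `2 * k - 1` are small in comparison to the clusters, in the form required by
`exists_highGirth_card_nbrsIn_eq`, for a cluster and one of its children. -/
theorem ball_mul_clusterDegree_lt (hk : 1 ≤ k)
    (hδ : (2 * Fintype.card (ClusterWord k)) ^ (2 * k) < δ)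
    {G : SimpleGraph (ClusterNode k δ (rootExponent k))}
    (hG : DegreesAtMost G (fun v => v.1) (clusterDegree δ))
    {u v : ClusterNode k δ (rootExponent k)} {i : ℕ} (h : v.1.1 = i :: u.1.1) :
    #{x | x.1 = u.1 ∧ Within G (2 * k - 1) v x} * clusterDegree δ u.1 v.1 +
      #{y | y.1 = v.1 ∧ Within G (2 * k - 1) u y} * clusterDegree δ v.1 u.1 <
        #{x : ClusterNode k δ (rootExponent k) | x.1 = u.1} * clusterDegree δ u.1 v.1 := by
  set F := Fintype.card (ClusterWord k) with hF
  have hF1 : 1 ≤ F := Fintype.card_pos_iff.2 ⟨u.1⟩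
  have hδ2 : 2 < δ := by
    refine lt_of_le_of_lt ?_ hδ
    calc 2 ≤ 2 * F := by omega
      _ = (2 * F) ^ 1 := (pow_one _).symm
      _ ≤ (2 * F) ^ (2 * k) := Nat.pow_le_pow_right (by omega) (by omega)
  have hlink : IsLink u.1.1 v.1.1 := Or.inl ⟨i, h⟩
  have huv : clusterDegree δ u.1 v.1 = δ ^ i := by
    rw [clusterDegree_of_isLink hlink, h, linkLabel_cons_right]
  have hvu : clusterDegree δ v.1 u.1 = δ ^ (i + 1) := by
    rw [clusterDegree_of_isLink hlink.symm, h, linkLabel_cons_left]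
  have hv := v.1.2
  rw [h] at hv
  have hlen := length_le_wordLevel u.1.1
  obtain ⟨-, hlev, hi, hup⟩ := hv
  have hne : u.1 ≠ v.1 := fun he => by
    have := congrArg List.length h
    rw [← he] at this
    simp at this
  rw [card_cluster, huv, hvu]
  by_cases hk1 : k = 1
  · subst hk1
    have hball : ∀ {a b : ClusterNode 1 δ (rootExponent 1)}, a.1 ≠ b.1 →
        #{x | x.1 = a.1 ∧ Within G (2 * 1 - 1) b x} ≤ clusterDegree δ b.1 a.1 := by
      intro a b hab
      refine (card_le_card fun x hx => ?_).trans (hG b a.1)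
      obtain ⟨hx, hw⟩ := (mem_filter.1 hx).2
      rcases within_one_iff.1 hw with hadj | rfl
      · exact mem_nbrsIn.2 ⟨hadj, hx⟩
      · exact absurd hx.symm hab
    have h1 := hball hne
    have h2 := hball hne.symm
    rw [hvu] at h1
    rw [huv] at h2
    -- A link with label `1` to a child leaves the root only: the parent of the other inner
    -- cluster `[0]` is at the end of its link with label `1`.
    have hlab : i + 1 + u.1.1.length < 3 := by
      rcases hu : u.1.1 with _ | ⟨j, w⟩
      · simp only [List.length_nil]; omega
      · rw [hu] at hlev hup hlen
        simp only [wordLevel, List.length_cons] at hlev hlen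
        simp only [upLabel, ne_eq, Option.some.injEq] at hup
        simp only [List.length_cons]
        omega
    have h3 : 2 * δ ^ (i + 1) < δ ^ (3 - u.1.1.length) := by
      calc 2 * δ ^ (i + 1) < δ * δ ^ (i + 1) := Nat.mul_lt_mul_of_pos_right hδ2 (by positivity)
        _ = δ ^ (i + 1 + 1) := by ring
        _ ≤ δ ^ (3 - u.1.1.length) := Nat.pow_le_pow_right (by omega) (by omega)
    calc _ ≤ δ ^ (i + 1) * δ ^ i + δ ^ i * δ ^ (i + 1) :=
          Nat.add_le_add (Nat.mul_le_mul_right _ h1) (Nat.mul_le_mul_right _ h2)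
      _ = 2 * δ ^ (i + 1) * δ ^ i := by ring
      _ < δ ^ (3 - u.1.1.length) * δ ^ i := Nat.mul_lt_mul_of_pos_right h3 (by positivity)
  · set b := (2 * F) ^ (2 * k - 1) * δ ^ ((k + 1) * (2 * k - 1)) with hb
    have hball : ∀ (c : ClusterWord k) (a : ClusterNode k δ (rootExponent k)),
        #{x | x.1 = c ∧ Within G (2 * k - 1) a x} ≤ b := by
      intro c a
      calc #{x | x.1 = c ∧ Within G (2 * k - 1) a x} ≤ {x | Within G (2 * k - 1) a x}.ncard := by
            rw [← Set.ncard_coe_finset]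
            refine Set.ncard_le_ncard (fun x hx => ?_) (Set.toFinite _)
            simp only [coe_filter, mem_univ, true_and] at hx
            exact hx.2
        _ ≤ (F * δ ^ (k + 1) + 1) ^ (2 * k - 1) :=
            ncard_within_le (ncard_neighbors_le (by omega) hG) _ _
        _ ≤ (2 * F * δ ^ (k + 1)) ^ (2 * k - 1) := by
            refine Nat.pow_le_pow_left ?_ _
            have : 1 ≤ F * δ ^ (k + 1) := Nat.mul_pos hF1 (by positivity)
            nlinarith
        _ = b := by rw [mul_pow, ← pow_mul, hb]
    have hexp : (k + 1) * (2 * k - 1) + 1 + 1 + k ≤ rootExponent k := by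
      rw [rootExponent, if_neg hk1]
      obtain ⟨j, rfl⟩ : ∃ j, k = j + 1 := ⟨k - 1, by omega⟩
      have : 2 * (j + 1) - 1 = 2 * j + 1 := by omega
      rw [this]
      nlinarith
    have hlt : b * (1 + δ) < δ ^ (rootExponent k - u.1.1.length) := by
      calc b * (1 + δ) ≤ b * (2 * F * δ) := by
            refine Nat.mul_le_mul_left _ ?_
            nlinarith
        _ = (2 * F) ^ (2 * k - 1 + 1) * δ ^ ((k + 1) * (2 * k - 1) + 1) := by rw [hb]; ring
        _ = (2 * F) ^ (2 * k) * δ ^ ((k + 1) * (2 * k - 1) + 1) := by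
            congr 2; omega
        _ < δ * δ ^ ((k + 1) * (2 * k - 1) + 1) := Nat.mul_lt_mul_of_pos_right hδ (by positivity)
        _ = δ ^ ((k + 1) * (2 * k - 1) + 1 + 1) := by ring
        _ ≤ _ := Nat.pow_le_pow_right (by omega) (by omega)
    calc _ ≤ b * δ ^ i + b * δ ^ (i + 1) :=
          Nat.add_le_add (Nat.mul_le_mul_right _ (hball _ _)) (Nat.mul_le_mul_right _ (hball _ _))
      _ = b * (1 + δ) * δ ^ i := by ring
      _ < _ := Nat.mul_lt_mul_of_pos_right hlt (by positivity)

theorem exists_isClusterGraph (hk : 1 ≤ k)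
    (hδ : (2 * Fintype.card (ClusterWord k)) ^ (2 * k) < δ) :
    ∃ G : SimpleGraph (ClusterNode k δ (rootExponent k)), HighGirth G (2 * k) ∧
      IsClusterGraph G k δ (fun v => v.1.1) ∧
      (∀ v, {w | G.Adj v w}.ncard ≤ Fintype.card (ClusterWord k) * δ ^ (k + 1)) ∧
      ∀ u v, G.Adj u v → IsLink u.1.1 v.1.1 := by
  classical
  obtain ⟨G, hgirth, hdeg⟩ := exists_highGirth_card_nbrsIn_eq hk
    (fun v : ClusterNode k δ (rootExponent k) => v.1) (clusterDegree δ) clusterDegree_self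
    (fun c d => by convert card_mul_clusterDegree_comm (succ_le_rootExponent k) c d)
    (fun G hG u v huv => by
      rcases isLink_of_clusterDegree_pos huv with ⟨i, h⟩ | ⟨i, h⟩
      · convert ball_mul_clusterDegree_lt hk hδ hG h
      · have := ball_mul_clusterDegree_lt hk hδ hG h
        rw [card_mul_clusterDegree_comm (succ_le_rootExponent k), add_comm] at this
        convert this)
  have hcap : DegreesAtMost G (fun v => v.1) (clusterDegree δ) := fun v d => (hdeg v d).le
  have hlink : ∀ u v, G.Adj u v → IsLink u.1.1 v.1.1 := by
    intro u v hadj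
    refine isLink_of_clusterDegree_pos (δ := δ) ?_
    rw [← hdeg u v.1]
    exact card_pos.2 ⟨v, mem_nbrsIn.2 ⟨hadj, rfl⟩⟩
  refine ⟨G, hgirth, ⟨fun u v h => (hlink u v h).hasLabel v.1.2,
    fun u v h => (hlink u v h).linkEnd_eq v.1.2, fun u i hi => ?_⟩,
    ncard_neighbors_le (by omega) hcap, hlink⟩
  have := hdeg u ⟨linkEnd u.1.1 i, u.1.2.linkEnd hi⟩
  rw [clusterDegree_of_isLink (isLink_linkEnd _ _), linkLabel_linkEnd] at this
  rw [← this]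
  congr 1
  ext w
  simp [mem_nbrsIn, Subtype.ext_iff]

theorem card_nonroot_le (hδ : 1 ≤ δ) :
    {v : ClusterNode k δ m | v.1.1 ≠ []}.ncard ≤ Fintype.card (ClusterWord k) * δ ^ (m - 1) := by
  classical
  have h : {v : ClusterNode k δ m | v.1.1 ≠ []} =
      ((univ.filter fun v => v.1.1 ≠ [] : Finset (ClusterNode k δ m)) : Set _) := by
    ext; simp
  rw [h, Set.ncard_coe_finset, mul_comm]
  refine (card_le_mul_card_image (f := fun w => w.1) _ (δ ^ (m - 1)) fun d hd => ?_).trans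
    (Nat.mul_le_mul_left _ (card_le_univ _))
  obtain ⟨v, hv, rfl⟩ := mem_image.1 hd
  have hlen : 1 ≤ v.1.1.length := List.length_pos_iff.2 (mem_filter.1 hv).2
  refine (card_le_card (t := univ.filter fun w => w.1 = v.1) fun w hw => ?_).trans ?_
  · simp only [mem_filter, mem_univ, true_and] at hw ⊢
    exact hw.2
  · rw [card_cluster]
    exact Nat.pow_le_pow_right hδ (by omega)

theorem card_clusterNode_le (hδ : 1 ≤ δ) :
    Fintype.card (ClusterNode k δ m) ≤ Fintype.card (ClusterWord k) * δ ^ m := by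
  rw [Fintype.card_sigma]
  refine (sum_le_card_nsmul _ _ (δ ^ m) fun w _ => ?_).trans (by simp)
  rw [Fintype.card_fin]
  exact Nat.pow_le_pow_right hδ (by omega)

end ClusterGraph

/-! ### Hard instances -/

/-- A certificate for a lower bound: the `a` nodes of `U` have the same views as their partners
`v u`, for each `u ∈ U` there is a node `w u` with no other neighbours than `u` and `v u`, and there
is a dominating set `S` of at most `s` nodes. The degrees are bounded by `D`, and some degree is
at least `N`. -/
structure HardInstance {V : Type*} [Fintype V] (G : SimpleGraph V) (k a s N D : ℕ) where
  U : Finset V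
  card_U : U.card = a
  v : V → V
  w : V → V
  injOn_w : Set.InjOn w U
  w_ne : ∀ u ∈ U, ∀ u' ∈ U, w u' ≠ u
  eq_of_adj_w : ∀ u ∈ U, ∀ y, G.Adj (w u) y → y = u ∨ y = v u
  exists_isViewIso : ∀ u ∈ U, ∃ φ, IsViewIso G k u (v u) φ
  S : Set V
  isDominatingSet : IsDominatingSet G S
  ncard_S_le : S.ncard ≤ s
  ncard_neighbors_le : ∀ x, {y | G.Adj x y}.ncard ≤ D
  exists_le_ncard_neighbors : ∃ x, N ≤ {y | G.Adj x y}.ncard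

section Transport

variable {V W : Type*} {G : SimpleGraph V} {H : SimpleGraph W} {k a s N D : ℕ}

theorem Within.map_iso (e : G ≃g H) {n : ℕ} {u v : V} (h : Within G n u v) :
    Within H n (e u) (e v) := by
  obtain ⟨p, hp⟩ := within_iff_exists_walk.1 h
  exact within_iff_exists_walk.2 ⟨p.map e.toHom, by simpa using hp⟩

theorem within_map_iso (e : G ≃g H) {n : ℕ} {u v : V} :
    Within H n (e u) (e v) ↔ Within G n u v := by
  refine ⟨fun h => ?_, Within.map_iso e⟩
  have := h.map_iso e.symm
  rwa [e.symm_apply_apply, e.symm_apply_apply] at this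

theorem edist_map_iso (e : G ≃g H) (u v : V) : H.edist (e u) (e v) = G.edist u v :=
  edist_eq_of_within_iff fun _ => within_map_iso e

theorem IsViewIso.map_iso {u v : V} {φ : V → V} (hφ : IsViewIso G k u v φ) (e : G ≃g H) :
    IsViewIso H k (e u) (e v) (fun x => e (φ (e.symm x))) where
  map_root := by rw [e.symm_apply_apply, hφ.map_root]
  edist_eq x hx := by
    obtain ⟨z, rfl⟩ := e.surjective x
    rw [e.symm_apply_apply, edist_map_iso, edist_map_iso, hφ.edist_eq z ((within_map_iso e).1 hx)]
  injOn x hx y hy hxy := by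
    obtain ⟨x, rfl⟩ := e.surjective x
    obtain ⟨y, rfl⟩ := e.surjective y
    simp only [e.symm_apply_apply] at hxy
    exact congrArg e (hφ.injOn ((within_map_iso e).1 hx) ((within_map_iso e).1 hy)
      (e.injective hxy))
  surj y hy := by
    obtain ⟨y, rfl⟩ := e.surjective y
    obtain ⟨z, hz, rfl⟩ := hφ.surj y ((within_map_iso e).1 hy)
    exact ⟨e z, (within_map_iso e).2 hz, by rw [e.symm_apply_apply]⟩
  adj_iff x y hx hy hne := by
    obtain ⟨x, rfl⟩ := e.surjective x
    obtain ⟨y, rfl⟩ := e.surjective y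
    rw [edist_map_iso, edist_map_iso] at hne
    rw [e.symm_apply_apply, e.symm_apply_apply, e.map_adj_iff, e.map_adj_iff,
      hφ.adj_iff x y ((within_map_iso e).1 hx) ((within_map_iso e).1 hy) hne]

theorem ncard_neighbors_iso (e : G ≃g H) (x : V) :
    {y | H.Adj (e x) y}.ncard = {y | G.Adj x y}.ncard := by
  rw [← Set.ncard_image_of_injective _ e.injective]
  congr 1
  ext y
  obtain ⟨y, rfl⟩ := e.surjective y
  simp [e.map_adj_iff]

variable [Fintype V] [Fintype W]

/-- A hard instance can be relabelled. -/
def HardInstance.mapIso (h : HardInstance G k a s N D) (e : G ≃g H) :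
    HardInstance H k a s N D where
  U := h.U.map e.toEquiv.toEmbedding
  card_U := by rw [Finset.card_map, h.card_U]
  v x := e (h.v (e.symm x))
  w x := e (h.w (e.symm x))
  injOn_w := by
    intro x hx y hy hxy
    obtain ⟨x, hx', rfl⟩ := Finset.mem_map.1 hx
    obtain ⟨y, hy', rfl⟩ := Finset.mem_map.1 hy
    have := e.injective hxy
    simp at this
    exact congrArg e (h.injOn_w hx' hy' this)
  w_ne := by
    intro x hx y hy hxy
    obtain ⟨x, hx', rfl⟩ := Finset.mem_map.1 hx
    obtain ⟨y, hy', rfl⟩ := Finset.mem_map.1 hy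
    have := e.injective hxy
    simp at this
    exact h.w_ne x hx' y hy' this
  eq_of_adj_w := by
    intro x hx y hxy
    obtain ⟨x, hx', rfl⟩ := Finset.mem_map.1 hx
    obtain ⟨y, rfl⟩ := e.surjective y
    rw [e.map_adj_iff] at hxy
    simp at hxy ⊢
    exact h.eq_of_adj_w x hx' y hxy
  exists_isViewIso := by
    intro x hx
    obtain ⟨x, hx', rfl⟩ := Finset.mem_map.1 hx
    obtain ⟨φ, hφ⟩ := h.exists_isViewIso x hx'
    have := hφ.map_iso e
    exact ⟨_, by simpa using this⟩
  S := e '' h.S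
  isDominatingSet := by
    intro x
    obtain ⟨x, rfl⟩ := e.surjective x
    rcases h.isDominatingSet x with hx | ⟨u, hu, hadj⟩
    · exact Or.inl ⟨x, hx, rfl⟩
    · exact Or.inr ⟨e u, ⟨u, hu, rfl⟩, e.map_adj_iff.2 hadj⟩
  ncard_S_le := (Set.ncard_image_of_injective _ e.injective).trans_le h.ncard_S_le
  ncard_neighbors_le := by
    intro x
    obtain ⟨x, rfl⟩ := e.surjective x
    rw [ncard_neighbors_iso e]
    exact h.ncard_neighbors_le x
  exists_le_ncard_neighbors := by
    obtain ⟨x, hx⟩ := h.exists_le_ncard_neighbors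
    exact ⟨e x, by rwa [ncard_neighbors_iso e]⟩

theorem HardInstance.highestDegree_le (h : HardInstance G k a s N D) : highestDegree G ≤ D := by
  classical
  rw [highestDegree]
  refine SimpleGraph.maxDegree_le_of_forall_degree_le _ _ fun v => ?_
  rw [← SimpleGraph.card_neighborFinset_eq_degree, ← Set.ncard_coe_finset]
  refine le_of_eq_of_le ?_ (h.ncard_neighbors_le v)
  congr 1
  ext; simp

theorem HardInstance.le_highestDegree (h : HardInstance G k a s N D) : N ≤ highestDegree G := by
  classical
  obtain ⟨x, hx⟩ := h.exists_le_ncard_neighbors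
  rw [highestDegree]
  refine le_trans ?_ (SimpleGraph.degree_le_maxDegree _ x)
  rw [← SimpleGraph.card_neighborFinset_eq_degree, ← Set.ncard_coe_finset]
  refine hx.trans_eq ?_
  congr 1
  ext; simp

end Transport

section EdgeNodes

variable {V : Type*} {G : SimpleGraph V} {D : ℕ}

theorem ncard_darts_symm (S : Set V) :
    {e : G.Dart | e.snd ∈ S}.ncard = {e : G.Dart | e.fst ∈ S}.ncard := by
  rw [← Set.ncard_image_of_injective _ (SimpleGraph.Dart.symm_involutive (G := G)).injective]
  congr 1
  ext e
  constructor
  · rintro ⟨f, hf, rfl⟩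
    exact hf
  · intro he
    exact ⟨e.symm, he, e.symm_symm⟩

variable [Fintype V]

theorem ncard_darts_le (hD : ∀ v, {w | G.Adj v w}.ncard ≤ D) (S : Set V) :
    {e : G.Dart | e.fst ∈ S}.ncard ≤ S.ncard * D := by
  classical
  have h : {e : G.Dart | e.fst ∈ S} =
      ((Finset.univ.filter fun e => e.fst ∈ S : Finset G.Dart) : Set _) := by
    ext; simp
  rw [h, Set.ncard_coe_finset, mul_comm, Set.ncard_eq_toFinset_card' S]
  refine Finset.card_le_mul_card_image_of_maps_to (f := fun e => e.fst)
    (fun e he => by simpa using he) D fun v _ => ?_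
  refine le_trans ?_ (hD v)
  rw [← Set.ncard_coe_finset]
  refine Set.ncard_le_ncard_of_injOn (fun e => e.snd) ?_ ?_ (Set.toFinite _)
  · intro e he
    simp only [Finset.coe_filter, Finset.mem_filter, Finset.mem_univ, true_and,
      Set.mem_ofPred_eq] at he
    rw [Set.mem_ofPred_eq, ← he.2]
    exact e.adj
  · intro e he f hf hef
    simp only [Finset.coe_filter, Finset.mem_filter, Finset.mem_univ, true_and,
      Set.mem_ofPred_eq] at he hf
    exact SimpleGraph.Dart.ext _ _ (Prod.ext (he.2.trans hf.2.symm) hef)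

/-- Each edge has an end in the vertex cover `S`. -/
theorem card_dart_le [Fintype G.Dart] (hD : ∀ v, {w | G.Adj v w}.ncard ≤ D) {S : Set V}
    (hS : ∀ u v, G.Adj u v → u ∈ S ∨ v ∈ S) : Fintype.card G.Dart ≤ 2 * (S.ncard * D) := by
  have h : (Set.univ : Set G.Dart) = {e | e.fst ∈ S} ∪ {e | e.snd ∈ S} := by
    ext e
    simpa using hS _ _ e.adj
  rw [← Nat.card_eq_fintype_card, ← Set.ncard_univ, h, two_mul]
  refine (Set.ncard_union_le _ _).trans (Nat.add_le_add (ncard_darts_le hD S) ?_)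
  rw [ncard_darts_symm]
  exact ncard_darts_le hD S

theorem ncard_neighbors_withEdgeNodes_le (hD : ∀ v, {w | G.Adj v w}.ncard ≤ D) (hD1 : 1 ≤ D)
    (x : V ⊕ G.Dart) : {y | (withEdgeNodes G).Adj x y}.ncard ≤ 3 * D := by
  classical
  rcases x with u | e
  · have h : {y | (withEdgeNodes G).Adj (.inl u) y} ⊆ (Sum.inl '' {w | G.Adj u w}) ∪
        ((Sum.inr '' {e : G.Dart | e.fst ∈ ({u} : Set V)}) ∪
          (Sum.inr '' {e : G.Dart | e.snd ∈ ({u} : Set V)})) := by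
      rintro (y | e) h
      · exact Or.inl ⟨y, h, rfl⟩
      · rcases withEdgeNodes_adj_inl_inr.1 h with h | h
        · exact Or.inr (Or.inl ⟨e, h.symm, rfl⟩)
        · exact Or.inr (Or.inr ⟨e, h.symm, rfl⟩)
    refine (Set.ncard_le_ncard h (Set.toFinite _)).trans ((Set.ncard_union_le _ _).trans ?_)
    have h1 := ncard_darts_le hD {u}
    have h2 := ncard_darts_symm (G := G) {u}
    have h3 := Set.ncard_union_le (Sum.inr (α := V) '' {e : G.Dart | e.fst ∈ ({u} : Set V)})
      (Sum.inr '' {e : G.Dart | e.snd ∈ ({u} : Set V)})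
    rw [Set.ncard_image_of_injective _ Sum.inr_injective,
      Set.ncard_image_of_injective _ Sum.inr_injective] at h3
    rw [Set.ncard_image_of_injective _ Sum.inl_injective]
    rw [Set.ncard_singleton] at h1
    have := hD u
    omega
  · have h : {y | (withEdgeNodes G).Adj (.inr e) y} ⊆ {.inl e.fst, .inl e.snd} := by
      rintro (y | f) h
      · rcases withEdgeNodes_adj_inr_inl.1 h with rfl | rfl <;> simp
      · exact h.elim
    have := Set.ncard_le_ncard h (Set.toFinite _)
    have h2 := Set.ncard_insert_le (Sum.inl e.fst : V ⊕ G.Dart) {.inl e.snd}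
    rw [Set.ncard_singleton] at h2
    omega

end EdgeNodes

section Instance

variable {k δ : ℕ}

/-- The cluster graph of high girth with nodes attached to its edges. -/
theorem exists_hardInstance (hk : 1 ≤ k)
    (hδ : (2 * Fintype.card (ClusterWord k)) ^ (2 * k) < δ) :
    ∃ (n : ℕ) (G : SimpleGraph (Fin n)),
      δ ≤ n ∧ n ≤ 3 * Fintype.card (ClusterWord k) ^ 2 * δ ^ (4 * k ^ 2) ∧
      Nonempty (HardInstance G k (δ ^ rootExponent k)
        (Fintype.card (ClusterWord k) * δ ^ (rootExponent k - 1)) δ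
        (3 * (Fintype.card (ClusterWord k) * δ ^ (k + 1)))) := by
  classical
  have hmk := succ_le_rootExponent k
  have hmk' := rootExponent_add_le hk
  have hgraph := exists_isClusterGraph hk hδ
  generalize rootExponent k = m at hgraph hmk hmk' ⊢
  set F := Fintype.card (ClusterWord k) with hF
  obtain ⟨G, hgirth, hG, hD, hlink⟩ := hgraph
  have hF1 : 1 ≤ F := Fintype.card_pos_iff.2 ⟨⟨[], trivial⟩⟩
  have hδ1 : 1 ≤ δ := by omega
  set cl : ClusterNode k δ m → List ℕ := fun v => v.1.1 with hcl
  set C : Set (ClusterNode k δ m) := {v | v.1.1 ≠ []} with hC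
  have hcover : ∀ u v, G.Adj u v → u ∈ C ∨ v ∈ C := by
    intro u v h
    rcases hlink u v h with ⟨i, h⟩ | ⟨i, h⟩
    · exact Or.inr (by rw [hC, Set.mem_ofPred_eq, h]; simp)
    · exact Or.inl (by rw [hC, Set.mem_ofPred_eq, h]; simp)
  have hCcard : C.ncard ≤ F * δ ^ (m - 1) := card_nonroot_le hδ1
  -- The number of neighbours of a root node in the cluster `[j]` is `δ ^ j`.
  have hroot : ∀ u, cl u = [] → ∀ j ≤ k, (nbrsIn G cl u [j]).card = δ ^ j := by
    intro u hu j hj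
    have hlev : wordLevel (cl u) ≤ k := by rw [hu]; exact Nat.zero_le _
    have := hG.card_nbrsIn u j (Or.inr ⟨hlev, hj⟩)
    rwa [hu, linkEnd_of_ne (by simp [upLabel])] at this
  have hpartner : ∀ u, ∃ v, cl u = [] → G.Adj u v ∧ cl v = [0] := by
    intro u
    by_cases hu : cl u = []
    · have h := hroot u hu 0 (Nat.zero_le _)
      obtain ⟨v, hv⟩ := Finset.card_pos.1 (h ▸ Nat.one_pos : 0 < (nbrsIn G cl u [0]).card)
      exact ⟨v, fun _ => mem_nbrsIn.1 hv⟩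
    · exact ⟨u, fun h => absurd h hu⟩
  choose partner hpartner using hpartner
  have hcardroot : (Finset.univ.filter fun u => cl u = []).card = δ ^ m := by
    have := card_cluster (k := k) (δ := δ) (m := m) ⟨[], trivial⟩
    simp only [List.length_nil, Nat.sub_zero] at this
    rw [← this]
    congr 1
    ext u
    simp [hcl, Subtype.ext_iff]
  have hrootpos : 0 < (Finset.univ.filter fun u => cl u = []).card := by
    rw [hcardroot]; positivity
  obtain ⟨u₀, hu₀⟩ := Finset.card_pos.1 hrootpos
  have hu₀ : cl u₀ = [] := by simpa using hu₀
  let edgeNode : ClusterNode k δ m → ClusterNode k δ m ⊕ G.Dart := fun u =>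
    if h : G.Adj u (partner u) then .inr ⟨(u, partner u), h⟩ else .inl u
  have hedge : ∀ u, cl u = [] → ∃ h : G.Adj u (partner u),
      edgeNode u = .inr ⟨(u, partner u), h⟩ := fun u hu =>
    ⟨(hpartner u hu).1, dif_pos (hpartner u hu).1⟩
  let T : Finset (ClusterNode k δ m ⊕ G.Dart) :=
    (Finset.univ.filter fun u => cl u = []).map ⟨Sum.inl, Sum.inl_injective⟩
  have hT : ∀ x ∈ T, ∃ u, cl u = [] ∧ x = .inl u := by
    intro x hx
    obtain ⟨u, hu, rfl⟩ := Finset.mem_map.1 hx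
    exact ⟨u, (Finset.mem_filter.1 hu).2, rfl⟩
  have hinst : HardInstance (withEdgeNodes G) k (δ ^ m) (F * δ ^ (m - 1)) δ
      (3 * (F * δ ^ (k + 1))) :=
    { U := T
      card_U := by rw [Finset.card_map, hcardroot]
      v := Sum.elim (fun u => .inl (partner u)) .inr
      w := Sum.elim edgeNode .inr
      injOn_w := by
        intro x hx y hy hxy
        obtain ⟨u, hu, rfl⟩ := hT x hx
        obtain ⟨u', hu', rfl⟩ := hT y hy
        obtain ⟨h, he⟩ := hedge u hu
        obtain ⟨h', he'⟩ := hedge u' hu'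
        simp only [Sum.elim_inl, he, he', Sum.inr.injEq, SimpleGraph.Dart.mk.injEq,
          Prod.mk.injEq] at hxy
        rw [hxy.1]
      w_ne := by
        intro x hx y hy hxy
        obtain ⟨u, hu, rfl⟩ := hT x hx
        obtain ⟨u', hu', rfl⟩ := hT y hy
        obtain ⟨h, he⟩ := hedge u' hu'
        simp [he] at hxy
      eq_of_adj_w := by
        intro x hx y hxy
        obtain ⟨u, hu, rfl⟩ := hT x hx
        obtain ⟨h, he⟩ := hedge u hu
        simp only [Sum.elim_inl, he] at hxy ⊢
        rcases y with y | e
        · rcases withEdgeNodes_adj_inr_inl.1 hxy with rfl | rfl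
          · exact Or.inl rfl
          · exact Or.inr rfl
        · exact hxy.elim
      exists_isViewIso := by
        intro x hx
        obtain ⟨u, hu, rfl⟩ := hT x hx
        obtain ⟨φ, hφ⟩ := hG.exists_isViewIso hgirth hu (hpartner u hu).2
        exact hφ.withEdgeNodes
      S := Sum.inl '' C
      isDominatingSet := by
        rintro (u | e)
        · by_cases hu : cl u = []
          · refine Or.inr ⟨.inl (partner u), ⟨partner u, ?_, rfl⟩, (hpartner u hu).1⟩
            have := (hpartner u hu).2
            rw [hC, Set.mem_ofPred_eq, show (partner u).1.1 = [0] from this]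
            simp
          · exact Or.inl ⟨u, hu, rfl⟩
        · rcases hcover _ _ e.adj with h | h
          · exact Or.inr ⟨_, ⟨_, h, rfl⟩, withEdgeNodes_adj_inr_inl.2 (Or.inl rfl)⟩
          · exact Or.inr ⟨_, ⟨_, h, rfl⟩, withEdgeNodes_adj_inr_inl.2 (Or.inr rfl)⟩
      ncard_S_le := (Set.ncard_image_of_injective _ Sum.inl_injective).trans_le hCcard
      ncard_neighbors_le := ncard_neighbors_withEdgeNodes_le hD (Nat.mul_pos hF1 (by positivity))
      exists_le_ncard_neighbors := by
        refine ⟨.inl u₀, ?_⟩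
        have h := hroot u₀ hu₀ 1 hk
        rw [pow_one, ← Set.ncard_coe_finset,
          ← Set.ncard_image_of_injective _ (Sum.inl_injective (β := G.Dart))] at h
        refine h.ge.trans (Set.ncard_le_ncard ?_ (Set.toFinite _))
        rintro _ ⟨y, hy, rfl⟩
        exact (mem_nbrsIn.1 hy).1 }
  refine ⟨_, (withEdgeNodes G).overFin rfl, ?_, ?_,
    ⟨hinst.mapIso ((withEdgeNodes G).overFinIso rfl)⟩⟩
  · rw [Fintype.card_sum]
    have h1 : δ ^ m ≤ Fintype.card (ClusterNode k δ m) := hcardroot ▸ Finset.card_le_univ _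
    have h2 : δ ^ 1 ≤ δ ^ m := Nat.pow_le_pow_right hδ1 (by omega)
    rw [pow_one] at h2
    omega
  · rw [Fintype.card_sum]
    have h1 : Fintype.card (ClusterNode k δ m) ≤ F * δ ^ m := card_clusterNode_le hδ1
    have h2 := card_dart_le hD hcover
    have h3 : δ ^ m ≤ δ ^ (m + k) := Nat.pow_le_pow_right hδ1 (by omega)
    have h4 : δ ^ (m + k) ≤ δ ^ (4 * k ^ 2) := Nat.pow_le_pow_right hδ1 hmk'
    have h5 : C.ncard * (F * δ ^ (k + 1)) ≤ F ^ 2 * δ ^ (m + k) := by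
      refine (Nat.mul_le_mul_right _ hCcard).trans (le_of_eq ?_)
      have : m + k = m - 1 + (k + 1) := by omega
      rw [this, pow_add]
      ring
    have h6 : F * δ ^ m ≤ F ^ 2 * δ ^ (m + k) := Nat.mul_le_mul (by nlinarith) h3
    calc _ ≤ F ^ 2 * δ ^ (m + k) + 2 * (F ^ 2 * δ ^ (m + k)) := by omega
      _ = 3 * F ^ 2 * δ ^ (m + k) := by ring
      _ ≤ 3 * F ^ 2 * δ ^ (4 * k ^ 2) := Nat.mul_le_mul_left _ h4

end Instance

/-! ### The ratio in terms of the number of nodes and of the highest degree -/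

section Bounds

theorem HardInstance.le_ratio {V I Ω : Type*} [Fintype V] [MeasurableSpace Ω] {G : SimpleGraph V}
    {k F m δ N D : ℕ} (h : HardInstance G k (δ ^ m) (F * δ ^ (m - 1)) N D) (hm : 1 ≤ m)
    (hδ : 1 ≤ δ) (hF : 1 ≤ F) (μ : Measure Ω) [IsProbabilityMeasure μ] (hI : Nonempty (V ↪ I)) :
    (∀ A : LocalAlgorithm I Ω Bool, SolvesDominatingSet A G k μ →
      ENNReal.ofReal (δ / (2 * F)) ≤ dominatingSetRatio A G k μ) ∧
    (∀ A : LocalAlgorithm I Ω ℝ≥0, SolvesFractionalDominatingSet A G k μ →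
      ENNReal.ofReal (δ / (2 * F)) ≤ fractionalDominatingSetRatio A G k μ) := by
  have key : ENNReal.ofReal (δ / (2 * F)) ≤ (h.U.card : ℝ≥0∞) / 2 / h.S.ncard := by
    have hδ0 : (0 : ℝ) < δ := by exact_mod_cast hδ
    have hF0 : (0 : ℝ) < F := by exact_mod_cast hF
    have hs : (0 : ℝ) < F * δ ^ (m - 1) := by positivity
    have h1 : (δ : ℝ) / (2 * F) = δ ^ m / 2 / (F * δ ^ (m - 1)) := by
      obtain ⟨j, rfl⟩ : ∃ j, m = j + 1 := ⟨m - 1, by omega⟩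
      rw [Nat.add_sub_cancel]
      field_simp
      ring
    rw [h1, h.card_U, ENNReal.ofReal_div_of_pos hs, ENNReal.ofReal_div_of_pos two_pos]
    refine ENNReal.div_le_div ?_ ?_
    · refine ENNReal.div_le_div ?_ (by simp)
      rw [← Nat.cast_pow, ENNReal.ofReal_natCast]
    · have h2 : (F : ℝ) * δ ^ (m - 1) = ((F * δ ^ (m - 1) : ℕ) : ℝ) := by push_cast; rfl
      rw [h2, ENNReal.ofReal_natCast]
      exact_mod_cast h.ncard_S_le
  exact ⟨fun A hA => key.trans (le_dominatingSetRatio hA hI h.U h.v h.w h.injOn_w h.w_ne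
      h.eq_of_adj_w h.exists_isViewIso h.isDominatingSet),
    fun A hA => key.trans (le_fractionalDominatingSetRatio hA hI h.U h.v h.w h.injOn_w h.w_ne
      h.eq_of_adj_w h.exists_isViewIso h.isDominatingSet)⟩

/-- If `x` is at most of the order `δ ^ E`, a power of `x` with an exponent less than `1 / E` is
smaller than `δ` by any constant factor, for large `δ`. -/
theorem rpow_le_div_of_le_mul_pow {C δ x p q η : ℝ} {E : ℕ} (hC : 1 ≤ C) (hδ : 1 ≤ δ) (hx : 1 ≤ x)
    (hxC : x ≤ C * δ ^ E) (hpq : p ≤ q) (hq0 : 0 ≤ q) (hq1 : q ≤ 1) (hqE : q * E ≤ 1 - η)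
    (hη : C ^ 2 ≤ δ ^ η) : x ^ p ≤ δ / C := by
  have hδ0 : 0 < δ := by linarith
  have hC0 : 0 < C := by linarith
  rw [le_div_iff₀ hC0]
  calc x ^ p * C ≤ x ^ q * C := by gcongr
    _ ≤ (C * δ ^ E) ^ q * C := by gcongr
    _ = C ^ q * δ ^ (q * E) * C := by
        rw [Real.mul_rpow hC0.le (by positivity), ← Real.rpow_natCast, ← Real.rpow_mul hδ0.le,
          mul_comm (E : ℝ)]
    _ ≤ C ^ (1 : ℝ) * δ ^ (1 - η) * C := by
        gcongr
    _ = C ^ 2 * δ ^ (1 - η) := by rw [Real.rpow_one]; ring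
    _ ≤ δ ^ η * δ ^ (1 - η) := by gcongr
    _ = δ := by rw [← Real.rpow_add hδ0, add_sub_cancel, Real.rpow_one]

end Bounds

theorem mainTheorem1 :
    ∀ ε : ℝ, 0 < ε → ∃ c : ℝ, 0 < c ∧ ∀ k : ℕ, 1 ≤ k → ∀ N : ℕ,
      ∃ (n : ℕ) (G : SimpleGraph (Fin n)), N ≤ n ∧ N ≤ highestDegree G ∧
        ∀ (I : Type*) (Ω : Type*) [MeasurableSpace Ω] (μ : Measure Ω) [IsProbabilityMeasure μ],
          Nonempty (Fin n ↪ I) →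
          (∀ A : LocalAlgorithm I Ω Bool, SolvesDominatingSet A G k μ →
            ENNReal.ofReal (c * (n : ℝ) ^ ((1 / 4 - ε) / (k : ℝ) ^ 2))
                ≤ dominatingSetRatio A G k μ ∧
              ENNReal.ofReal (c * (highestDegree G : ℝ) ^ ((1 - ε) / ((k : ℝ) + 1)))
                ≤ dominatingSetRatio A G k μ) ∧
          (∀ A : LocalAlgorithm I Ω ℝ≥0, SolvesFractionalDominatingSet A G k μ →
            ENNReal.ofReal (c * (n : ℝ) ^ ((1 / 4 - ε) / (k : ℝ) ^ 2))
                ≤ fractionalDominatingSetRatio A G k μ ∧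
              ENNReal.ofReal (c * (highestDegree G : ℝ) ^ ((1 - ε) / ((k : ℝ) + 1)))
                ≤ fractionalDominatingSetRatio A G k μ) := by
  intro ε hε
  refine ⟨1, one_pos, fun k hk N => ?_⟩
  set F := Fintype.card (ClusterWord k) with hF
  have hF1 : 1 ≤ F := Fintype.card_pos_iff.2 ⟨⟨[], trivial⟩⟩
  -- For large `ε` the exponents are negative; they are bounded by those for `η`.
  set η : ℝ := min ε (1 / 8) with hη
  have hη0 : 0 < η := lt_min hε (by norm_num)
  have hηε : η ≤ ε := min_le_left _ _
  have hη8 : η ≤ 1 / 8 := min_le_right _ _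
  set C : ℝ := 3 * (F : ℝ) ^ 2 with hC
  have hF1' : (1 : ℝ) ≤ F := by exact_mod_cast hF1
  have hC1 : 1 ≤ C := by nlinarith
  have hlarge : ∀ᶠ δ : ℕ in Filter.atTop, C ^ 2 ≤ (δ : ℝ) ^ η :=
    ((tendsto_rpow_atTop hη0).comp tendsto_natCast_atTop_atTop).eventually_ge_atTop _
  obtain ⟨δ, hδη, hδF, hδN⟩ := (hlarge.and ((Filter.eventually_gt_atTop ((2 * F) ^ (2 * k))).and
    (Filter.eventually_ge_atTop N))).exists
  obtain ⟨n, G, hδn, hn, ⟨h⟩⟩ := exists_hardInstance hk hδF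
  have hδ1 : 1 ≤ δ := by omega
  have hδ1' : (1 : ℝ) ≤ δ := by exact_mod_cast hδ1
  have hk' : (1 : ℝ) ≤ k := by exact_mod_cast hk
  have hdiv : (δ : ℝ) / C ≤ δ / (2 * F) := by
    gcongr
    nlinarith
  have hbound1 : (n : ℝ) ^ ((1 / 4 - ε) / (k : ℝ) ^ 2) ≤ δ / (2 * F) := by
    refine (rpow_le_div_of_le_mul_pow (q := (1 / 4 - η) / (k : ℝ) ^ 2) (E := 4 * k ^ 2) hC1 hδ1'
      (by exact_mod_cast hδ1.trans hδn) (by rw [hC, hF]; exact_mod_cast hn)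
      ?_ ?_ ?_ ?_ hδη).trans hdiv
    · gcongr
    · exact div_nonneg (by linarith) (by positivity)
    · rw [div_le_one (by positivity)]
      nlinarith
    · push_cast
      have : (1 / 4 - η) / (k : ℝ) ^ 2 * (4 * (k : ℝ) ^ 2) = 1 - 4 * η := by field_simp
      rw [this]
      linarith
  have hbound2 : (highestDegree G : ℝ) ^ ((1 - ε) / ((k : ℝ) + 1)) ≤ δ / (2 * F) := by
    refine (rpow_le_div_of_le_mul_pow (q := (1 - η) / ((k : ℝ) + 1)) (E := k + 1) hC1 hδ1'
      (by exact_mod_cast hδ1.trans h.le_highestDegree) ?_ ?_ ?_ ?_ ?_ hδη).trans hdiv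
    · have h1 : (highestDegree G : ℝ) ≤ ((3 * (F * δ ^ (k + 1)) : ℕ) : ℝ) := by
        exact_mod_cast h.highestDegree_le
      refine h1.trans ?_
      push_cast
      rw [hC, ← mul_assoc]
      gcongr
      nlinarith
    · gcongr
    · exact div_nonneg (by linarith) (by positivity)
    · rw [div_le_one (by positivity)]
      linarith
    · push_cast
      rw [div_mul_cancel₀ _ (by positivity)]
  refine ⟨n, G, hδN.trans hδn, hδN.trans h.le_highestDegree, ?_⟩
  intro I Ω _ μ _ hI
  obtain ⟨h1, h2⟩ := h.le_ratio ((Nat.le_add_left 1 k).trans (succ_le_rootExponent k)) hδ1 hF1 μ hI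
  simp only [one_mul]
  exact ⟨fun A hA => ⟨(ENNReal.ofReal_le_ofReal hbound1).trans (h1 A hA),
      (ENNReal.ofReal_le_ofReal hbound2).trans (h1 A hA)⟩,
    fun A hA => ⟨(ENNReal.ofReal_le_ofReal hbound1).trans (h2 A hA),
      (ENNReal.ofReal_le_ofReal hbound2).trans (h2 A hA)⟩⟩
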